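/- Let $d\ge 1$ be an integer, let $1<p<2$, and let $p'$ be the conjugate exponent, $\frac1p+\frac1{p'}=1$. For a measurable function $g$ on $\mathbb{R}^d$ let $g^*(t)=\inf\{\tau>0:\ |\{x:|g(x)|>\tau\}|\le t\}$, $t>0$, be its nonincreasing rearrangement, and let $L^{p',p}(\mathbb{R}^d)$ be the Lorentz space of (classes of a.e. equal) complex measurable functions $g$ with $$\|g\|_{p',p}=\Big(\int_0^\infty \big(t^{1/p'}g^*(t)\big)^p\,\frac{dt}{t}\Big)^{1/p}<\infty .$$ Then the Fourier transform, given by $\mathcal{F}f(x)=\int_{\mathbb{R}^d} f(t)e^{-i\langle x,t\rangle}\,dt$ for $f\in L^1(\mathbb{R}^d)\cap L^p(\mathbb{R}^d)$, extends to a bounded linear operator $$\mathcal{F}:L^p(\mathbb{R}^d)\to L^{p',p}(\mathbb{R}^d),$$ and this operator is not strictly singular. That is, it is not the case that for every infinite-dimensional closed subspace $E\subset L^p(\mathbb{R}^d)$ and every $\varepsilon>0$ there is $f\in E$ with $\|f\|_p=1$ and $\|\mathcal{F}f\|_{p',p}\le\varepsilon$. This holds both for the complex space $L^p(\mathbb{R}^d)$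 of complex-valued functions (with complex subspaces $E$) and for the real space $L^p(\mathbb{R}^d)$ of real-valued functions (with real subspaces $E$). -/

import Mathlib

open MeasureTheory Set
open scoped ENNReal

noncomputable section

section Rearrangement

variable {α : Type*} [MeasurableSpace α]

/-- The distribution function `f_*(τ) = μ {x : |f x| > τ}`. -/
def distribution (μ : Measure α) (f : α → ℂ) (τ : ℝ≥0∞) : ℝ≥0∞ :=
  μ {x | τ < ‖f x‖ₑ}

/-- The nonincreasing rearrangement `f^*(t) = inf {τ > 0 : f_*(τ) ≤ t}`. The value `τ = ∞` is
always admissible, which realizes the convention `inf ∅ = ∞`. -/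
def rearrangement (μ : Measure α) (f : α → ℂ) (t : ℝ) : ℝ≥0∞ :=
  sInf {τ : ℝ≥0∞ | 0 < τ ∧ distribution μ f τ ≤ ENNReal.ofReal t}

/-- The Lorentz functional
`‖f‖_{r,s} = (∫_0^∞ (t^{1/r} f^*(t))^s dt/t)^{1/s} ∈ [0,∞]`, for `0 < r, s < ∞`. -/
def lorentzENorm (μ : Measure α) (r s : ℝ) (f : α → ℂ) : ℝ≥0∞ :=
  (∫⁻ t in Ioi (0 : ℝ),
    (ENNReal.ofReal (t ^ (1 / r)) * rearrangement μ f t) ^ s / ENNReal.ofReal t) ^ (1 / s)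

lemma rearrangement_antitone (μ : Measure α) (f : α → ℂ) : Antitone (rearrangement μ f) := by
  intro a b hab
  exact sInf_le_sInf fun τ hτ => ⟨hτ.1, hτ.2.trans (ENNReal.ofReal_le_ofReal hab)⟩

lemma rearrangement_congr {μ : Measure α} {f g : α → ℂ} (h : f =ᵐ[μ] g) :
    rearrangement μ f = rearrangement μ g := by
  have hd : distribution μ f = distribution μ g := by
    funext τ
    refine measure_congr ?_
    filter_upwards [h] with x hx
    change (τ < ‖f x‖ₑ) = (τ < ‖g x‖ₑ)
    rw [hx]
  funext t
  simp only [rearrangement, hd]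

lemma lorentzENorm_congr {μ : Measure α} {f g : α → ℂ} (r s : ℝ) (h : f =ᵐ[μ] g) :
    lorentzENorm μ r s f = lorentzENorm μ r s g := by
  simp only [lorentzENorm, rearrangement_congr h]

lemma rearrangement_add_le (μ : Measure α) (f g : α → ℂ) {t : ℝ} (ht : 0 ≤ t) :
    rearrangement μ (f + g) t ≤ rearrangement μ f (t / 2) + rearrangement μ g (t / 2) := by
  unfold rearrangement
  rw [sInf_eq_iInf (s := {τ : ℝ≥0∞ | 0 < τ ∧ distribution μ f τ ≤ ENNReal.ofReal (t / 2)}),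
    sInf_eq_iInf (s := {τ : ℝ≥0∞ | 0 < τ ∧ distribution μ g τ ≤ ENNReal.ofReal (t / 2)})]
  refine ENNReal.le_iInf₂_add_iInf₂ fun σ hσ τ hτ => sInf_le ⟨by simp [hσ.1], ?_⟩
  calc distribution μ (f + g) (σ + τ)
      ≤ μ ({x | σ < ‖f x‖ₑ} ∪ {x | τ < ‖g x‖ₑ}) := by
        refine measure_mono fun x hx => ?_
        by_contra hc
        simp only [mem_union, mem_ofPred_eq, not_or, not_lt] at hc hx
        exact absurd hx (not_lt.mpr ((enorm_add_le _ _).trans (add_le_add hc.1 hc.2)))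
    _ ≤ ENNReal.ofReal (t / 2) + ENNReal.ofReal (t / 2) :=
        (measure_union_le _ _).trans (add_le_add hσ.2 hτ.2)
    _ = ENNReal.ofReal t := by
        rw [← ENNReal.ofReal_add (by positivity) (by positivity), add_halves]

lemma rearrangement_smul_le (μ : Measure α) (c : ℂ) (f : α → ℂ) (t : ℝ) :
    rearrangement μ (c • f) t ≤ ‖c‖ₑ * rearrangement μ f t := by
  rcases eq_or_ne c 0 with rfl | hc
  · refine le_of_forall_gt fun τ hτ => ?_
    obtain ⟨ρ, hρ, hρτ⟩ := exists_between hτ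
    refine lt_of_le_of_lt (sInf_le ⟨by simpa using hρ, ?_⟩) hρτ
    simp [distribution]
  · have hc0 : ‖c‖ₑ ≠ 0 := by simpa using hc
    unfold rearrangement
    rw [sInf_eq_iInf (s := {τ : ℝ≥0∞ | 0 < τ ∧ distribution μ f τ ≤ ENNReal.ofReal t})]
    simp only [ENNReal.mul_iInf_of_ne hc0 enorm_ne_top]
    refine le_iInf₂ fun τ hτ => sInf_le ⟨ENNReal.mul_pos hc0 hτ.1.ne', ?_⟩
    refine le_trans (le_of_eq ?_) hτ.2
    unfold distribution
    congr 1
    ext x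
    simp only [mem_ofPred_eq, Pi.smul_apply, enorm_smul]
    exact ENNReal.mul_lt_mul_iff_right hc0 enorm_ne_top

lemma lorentzENorm_lt_top_iff {μ : Measure α} {r s : ℝ} (hs : 0 < s) {f : α → ℂ} :
    lorentzENorm μ r s f < ∞ ↔
      ∫⁻ t in Ioi (0 : ℝ), (ENNReal.ofReal (t ^ (1 / r)) * rearrangement μ f t) ^ s /
        ENNReal.ofReal t < ∞ := by
  have h : 0 < 1 / s := by positivity
  exact ENNReal.rpow_lt_top_iff_of_pos h

lemma measurable_lorentz_integrand (μ : Measure α) (r s : ℝ) (f : α → ℂ) :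
    Measurable fun t : ℝ =>
      (ENNReal.ofReal (t ^ (1 / r)) * rearrangement μ f t) ^ s / ENNReal.ofReal t := by
  have := (rearrangement_antitone μ f).measurable
  fun_prop

lemma lorentzENorm_smul_lt_top {μ : Measure α} {r s : ℝ} (hs : 0 < s) (c : ℂ) {f : α → ℂ}
    (hf : lorentzENorm μ r s f < ∞) : lorentzENorm μ r s (c • f) < ∞ := by
  rw [lorentzENorm_lt_top_iff hs] at hf ⊢
  refine lt_of_le_of_lt ?_ (ENNReal.mul_lt_top
    (ENNReal.rpow_lt_top_of_nonneg hs.le (enorm_ne_top (x := c))) hf)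
  rw [← lintegral_const_mul _ (measurable_lorentz_integrand μ r s f)]
  refine lintegral_mono fun t => ?_
  rw [← mul_div_assoc, ← ENNReal.mul_rpow_of_nonneg _ _ hs.le]
  refine ENNReal.div_le_div_right (ENNReal.rpow_le_rpow ?_ hs.le) _
  rw [mul_left_comm]
  exact mul_le_mul_right (rearrangement_smul_le μ c f t) _

lemma lintegral_lorentz_half_lt_top {μ : Measure α} {r s : ℝ} (hs : 0 < s) {f : α → ℂ}
    (hf : lorentzENorm μ r s f < ∞) :
    ∫⁻ t in Ioi (0 : ℝ), (ENNReal.ofReal (t ^ (1 / r)) * rearrangement μ f (t / 2)) ^ s /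
        ENNReal.ofReal t < ∞ := by
  rw [lorentzENorm_lt_top_iff hs] at hf
  set F : ℝ → ℝ≥0∞ := fun t =>
    (ENNReal.ofReal (t ^ (1 / r)) * rearrangement μ f t) ^ s / ENNReal.ofReal t with hF
  have hFm : Measurable F := measurable_lorentz_integrand μ r s f
  have hscale : ∫⁻ t in Ioi (0 : ℝ), F (2⁻¹ * t) < ∞ := by
    have h1 : ∫⁻ t in Ioi (0 : ℝ), F (2⁻¹ * t)
        = ∫⁻ t, (Ioi (0 : ℝ)).indicator F (2⁻¹ * t) := by
      rw [← lintegral_indicator measurableSet_Ioi]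
      refine lintegral_congr fun t => ?_
      by_cases ht : 0 < t
      · rw [indicator_of_mem (by exact ht), indicator_of_mem (by simpa using ht)]
      · rw [indicator_of_notMem (by exact ht), indicator_of_notMem (by simpa using ht)]
    rw [h1, ← lintegral_map (hFm.indicator measurableSet_Ioi) (by fun_prop),
      Real.map_volume_mul_left (by norm_num), lintegral_smul_measure,
      lintegral_indicator measurableSet_Ioi]
    exact ENNReal.mul_lt_top ENNReal.ofReal_lt_top hf
  set c : ℝ≥0∞ := ENNReal.ofReal ((2 : ℝ) ^ (1 / r)) ^ s with hc
  have hct : c < ∞ := ENNReal.rpow_lt_top_of_nonneg hs.le ENNReal.ofReal_ne_top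
  refine lt_of_le_of_lt ?_ (ENNReal.mul_lt_top hct hscale)
  rw [← lintegral_const_mul _ (by fun_prop)]
  refine setLIntegral_mono (by fun_prop) fun t ht => ?_
  have ht : 0 < t := ht
  have e1 : (2⁻¹ * t : ℝ) = t / 2 := by ring
  have e2 : t ^ (1 / r) = 2 ^ (1 / r) * (t / 2) ^ (1 / r) := by
    rw [← Real.mul_rpow (by norm_num) (by positivity)]
    congr 1; ring
  simp only [hF, e1, hc]
  rw [← mul_div_assoc, ← ENNReal.mul_rpow_of_nonneg _ _ hs.le, ← mul_assoc,
    ← ENNReal.ofReal_mul (by positivity), ← e2]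
  gcongr
  linarith

lemma lorentzENorm_add_lt_top {μ : Measure α} {r s : ℝ} (hs : 0 < s) {f g : α → ℂ}
    (hf : lorentzENorm μ r s f < ∞) (hg : lorentzENorm μ r s g < ∞) :
    lorentzENorm μ r s (f + g) < ∞ := by
  have hf' := lintegral_lorentz_half_lt_top hs hf
  have hg' := lintegral_lorentz_half_lt_top hs hg
  rw [lorentzENorm_lt_top_iff hs]
  have hmeas : ∀ h : α → ℂ, Measurable fun t : ℝ =>
      (ENNReal.ofReal (t ^ (1 / r)) * rearrangement μ h (t / 2)) ^ s / ENNReal.ofReal t := by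
    intro h
    have := (rearrangement_antitone μ h).measurable
    fun_prop
  have h2 : (2 : ℝ≥0∞) ^ s < ∞ := ENNReal.rpow_lt_top_of_nonneg hs.le (by simp)
  refine lt_of_le_of_lt ?_ (ENNReal.mul_lt_top h2 (ENNReal.add_lt_top.mpr ⟨hf', hg'⟩))
  rw [← lintegral_add_left (hmeas f),
    ← lintegral_const_mul (2 ^ s) (by exact (hmeas f).add (hmeas g))]
  refine setLIntegral_mono (((hmeas f).add (hmeas g)).const_mul _) fun t ht => ?_
  rw [← ENNReal.add_div, ← mul_div_assoc]
  gcongr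
  set A := ENNReal.ofReal (t ^ (1 / r)) * rearrangement μ f (t / 2)
  set B := ENNReal.ofReal (t ^ (1 / r)) * rearrangement μ g (t / 2)
  have hAB : ENNReal.ofReal (t ^ (1 / r)) * rearrangement μ (f + g) t ≤ 2 * max A B := by
    calc _ ≤ ENNReal.ofReal (t ^ (1 / r)) *
          (rearrangement μ f (t / 2) + rearrangement μ g (t / 2)) := by
          gcongr; exact rearrangement_add_le μ f g (le_of_lt ht)
      _ = A + B := mul_add _ _ _
      _ ≤ max A B + max A B := add_le_add (le_max_left _ _) (le_max_right _ _)
      _ = 2 * max A B := (two_mul _).symm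
  calc _ ≤ (2 * max A B) ^ s := ENNReal.rpow_le_rpow hAB hs.le
    _ = 2 ^ s * (max A B) ^ s := ENNReal.mul_rpow_of_nonneg _ _ hs.le
    _ ≤ 2 ^ s * (A ^ s + B ^ s) := by
        gcongr
        rcases le_total A B with h | h
        · rw [max_eq_right h]; exact le_add_self
        · rw [max_eq_left h]; exact le_self_add

end Rearrangement

/-- The Lorentz space `L^{r,s}(μ)`, `r, s ∈ (0,∞)`: classes of a.e. equal complex measurable
functions with `‖f‖_{r,s} < ∞`. -/
def lorentzSpace {α : Type*} [MeasurableSpace α] (μ : Measure α) {r s : ℝ}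
    (_hr : 0 < r) (hs : 0 < s) : Submodule ℂ (α →ₘ[μ] ℂ) where
  carrier := {f | lorentzENorm μ r s f < ∞}
  zero_mem' := by
    have h : lorentzENorm μ r s ((0 : ℂ) • (0 : α → ℂ)) < ∞ := by
      rw [lorentzENorm_lt_top_iff hs]
      have h0 : ∀ t, rearrangement μ ((0 : ℂ) • (0 : α → ℂ)) t = 0 := fun t =>
        le_antisymm ((rearrangement_smul_le μ 0 0 t).trans (by simp)) zero_le
      simp only [h0, mul_zero, ENNReal.zero_rpow_of_pos hs, ENNReal.zero_div, lintegral_zero,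
        ENNReal.zero_lt_top]
    rw [zero_smul] at h
    exact (lorentzENorm_congr r s (AEEqFun.coeFn_zero (μ := μ) (β := ℂ))).trans_lt h
  add_mem' {f g} hf hg :=
    (lorentzENorm_congr r s (AEEqFun.coeFn_add f g)).trans_lt (lorentzENorm_add_lt_top hs hf hg)
  smul_mem' c f hf :=
    (lorentzENorm_congr r s (AEEqFun.coeFn_smul c f)).trans_lt (lorentzENorm_smul_lt_top hs c hf)

/-- `‖f‖_{r,s}` on the Lorentz space, as a real number (finite by membership). -/
instance {α : Type*} [MeasurableSpace α] (μ : Measure α) {r s : ℝ} (hr : 0 < r) (hs : 0 < s) :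
    Norm (lorentzSpace μ hr hs) where
  norm f := (lorentzENorm μ r s (f : α →ₘ[μ] ℂ)).toReal

/-- A linear map `T` from a normed space `X` to a space `Y` with a (quasi-)norm is bounded. -/
def IsBoundedOperator {𝕜 X Y : Type*} [NontriviallyNormedField 𝕜] [NormedAddCommGroup X]
    [NormedSpace 𝕜 X] [AddCommMonoid Y] [Module 𝕜 Y] [Norm Y] (T : X →ₗ[𝕜] Y) : Prop :=
  ∃ C : ℝ, ∀ x : X, ‖T x‖ ≤ C * ‖x‖

/-- `T` is strictly singular: for every infinite-dimensional closed subspace `V` of `X` and every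
`ε > 0` there is `x` in the unit sphere of `V` with `‖T x‖ ≤ ε`. -/
def IsStrictlySingular {𝕜 X Y : Type*} [NontriviallyNormedField 𝕜] [NormedAddCommGroup X]
    [NormedSpace 𝕜 X] [AddCommMonoid Y] [Module 𝕜 Y] [Norm Y] (T : X →ₗ[𝕜] Y) : Prop :=
  ∀ V : Submodule 𝕜 X, IsClosed (V : Set X) → ¬ FiniteDimensional 𝕜 V →
    ∀ ε : ℝ, 0 < ε → ∃ x ∈ V, ‖x‖ = 1 ∧ ‖T x‖ ≤ ε

/-- The Fourier integral `∫ f(t) e^{-i⟨x,t⟩} dt` of a function on `ℝ^d`. -/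
def fourierIntegralFun {d : ℕ} (f : EuclideanSpace ℝ (Fin d) → ℂ)
    (x : EuclideanSpace ℝ (Fin d)) : ℂ :=
  ∫ t, f t * Complex.exp (-(Complex.I * ((inner ℝ x t : ℝ) : ℂ)))

/-- `T` is the Fourier transform `L^p(ℝ^d) → L^{r,s}(ℝ^d)`: the bounded linear operator which is
given by the Fourier integral on `L^1 ∩ L^p`. As `L^1 ∩ L^p` is dense in `L^p` for `p < ∞`, there is
at most one such `T`. -/
structure IsFourierTransform {d : ℕ} {p : ℝ≥0∞} [Fact (1 ≤ p)] {r s : ℝ} {hr : 0 < r} {hs : 0 < s}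
    (T : Lp ℂ p (volume : Measure (EuclideanSpace ℝ (Fin d))) →ₗ[ℂ]
      lorentzSpace (volume : Measure (EuclideanSpace ℝ (Fin d))) hr hs) : Prop where
  bounded : IsBoundedOperator T
  eq_integral : ∀ f : Lp ℂ p (volume : Measure (EuclideanSpace ℝ (Fin d))),
    Integrable f volume →
      ((T f : EuclideanSpace ℝ (Fin d) →ₘ[volume] ℂ) : EuclideanSpace ℝ (Fin d) → ℂ)
        =ᵐ[volume] fourierIntegralFun f

/-- The inclusion of the real-valued functions in `L^p(ℝ^d)` into the complex-valued ones. -/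
def realToComplexLp (d : ℕ) (p : ℝ≥0∞) [Fact (1 ≤ p)] :
    Lp ℝ p (volume : Measure (EuclideanSpace ℝ (Fin d))) →ₗ[ℝ]
      Lp ℂ p (volume : Measure (EuclideanSpace ℝ (Fin d))) :=
  (Complex.ofRealCLM.compLpL p volume).toLinearMap

end

/-!
A Paley inequality, obtained by Marcinkiewicz interpolation (split `f` at a height depending on `t`
into an `L¹` part, whose transform is bounded, and an `L²` part, to which Plancherel applies), shows
that the Fourier transform maps `L^p` into `L^{p',p}`.

It is bounded below on the span of a lacunary family of dilates. Fix a Schwartz function whose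
Fourier transform is supported in an annulus and dilate it, with `L^p` normalization, by `2^{k²}`.
The dilates are concentrated on almost disjoint shells, so they satisfy an upper `ℓ^p` estimate in
`L^p`. Their Fourier transforms live on disjoint annuli whose measures grow so fast that the
rearrangement of a sum sees them one at a time, which gives the lower `ℓ^p` estimate in `L^{p',p}`.
As the Schwartz function can be chosen real-valued, the same family serves both scalar fields.
-/

noncomputable section

open Filter Topology Module ENNReal
open scoped NNReal FourierTransform SchwartzMap

section Rearrangement

variable {α : Type*} [MeasurableSpace α] {μ : Measure α} {f g : α → ℂ} {t : ℝ}

lemma distribution_antitone (μ : Measure α) (f : α → ℂ) : Antitone (distribution μ f) :=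
  fun _ _ hστ => measure_mono fun _ hx => hστ.trans_lt hx

lemma distribution_le_of_forall_gt {τ c : ℝ≥0∞} (h : ∀ σ, τ < σ → distribution μ f σ ≤ c) :
    distribution μ f τ ≤ c := by
  rcases eq_or_ne τ ∞ with rfl | hτ
  · simp [distribution]
  obtain ⟨u, hu_anti, hu_gt, hu_lim⟩ := exists_seq_strictAnti_tendsto' hτ.lt_top
  have hUnion : {x | τ < ‖f x‖ₑ} = ⋃ n, {x | u n < ‖f x‖ₑ} := by
    ext x
    simp only [mem_ofPred_eq, mem_iUnion]
    exact ⟨fun hx => (hu_lim.eventually_lt_const hx).exists,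
      fun ⟨n, hn⟩ => (hu_gt n).1.trans hn⟩
  have hmono : Monotone fun n => {x | u n < ‖f x‖ₑ} :=
    fun m n hmn x hx => (hu_anti.antitone hmn).trans_lt hx
  rw [distribution, hUnion, hmono.measure_iUnion]
  exact iSup_le fun n => h _ (hu_gt n).1

lemma rearrangement_le_iff {τ : ℝ≥0∞} :
    rearrangement μ f t ≤ τ ↔ distribution μ f τ ≤ ENNReal.ofReal t := by
  constructor
  · intro h
    refine distribution_le_of_forall_gt fun σ hσ => ?_
    obtain ⟨ρ, ⟨-, hρ⟩, hρσ⟩ := sInf_lt_iff.mp (h.trans_lt hσ)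
    exact (distribution_antitone μ f hρσ.le).trans hρ
  · intro h
    exact le_of_forall_gt_imp_ge_of_dense fun σ hσ =>
      sInf_le ⟨pos_of_gt hσ, (distribution_antitone μ f hσ.le).trans h⟩

lemma lt_rearrangement_iff {τ : ℝ≥0∞} :
    τ < rearrangement μ f t ↔ ENNReal.ofReal t < distribution μ f τ := by
  simp only [← not_le, rearrangement_le_iff]

lemma distribution_rearrangement_le : distribution μ f (rearrangement μ f t) ≤ ENNReal.ofReal t :=
  rearrangement_le_iff.mp le_rfl

lemma le_rearrangement {E : Set α} {b : ℝ≥0∞} (hE : ENNReal.ofReal t < μ E)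
    (hb : ∀ x ∈ E, b ≤ ‖f x‖ₑ) : b ≤ rearrangement μ f t := by
  by_contra! hlt
  exact hE.not_ge <|
    (measure_mono fun x hx => hlt.trans_le (hb x hx)).trans distribution_rearrangement_le

lemma rearrangement_add_le_of_enorm_le {A : ℝ≥0∞} (hf : ∀ x, ‖f x‖ₑ ≤ A) :
    rearrangement μ (f + g) t ≤ A + rearrangement μ g t := by
  refine rearrangement_le_iff.mpr (le_trans (measure_mono fun x hx => ?_)
    (distribution_rearrangement_le (f := g)))
  have hx : A + rearrangement μ g t < ‖f x + g x‖ₑ := hx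
  by_contra hle
  exact hx.not_ge ((enorm_add_le _ _).trans (add_le_add (hf x) (not_lt.mp hle)))

lemma rearrangement_le_of_lintegral {p : ℝ} (hp : 0 < p) (hf : AEStronglyMeasurable f μ)
    (ht : 0 < t) :
    rearrangement μ f t ≤ ((∫⁻ x, ‖f x‖ₑ ^ p ∂μ) / ENNReal.ofReal t) ^ (1 / p) := by
  refine le_of_forall_lt_imp_le_of_dense fun σ hσ => ?_
  rw [one_div, ENNReal.le_rpow_inv_iff hp, ENNReal.le_div_iff_mul_le (by simp [ht]) (by simp)]
  calc σ ^ p * ENNReal.ofReal t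
      ≤ σ ^ p * μ {x | σ ^ p ≤ ‖f x‖ₑ ^ p} := by
        gcongr
        refine (lt_rearrangement_iff.mp hσ).le.trans (measure_mono fun x (hx : σ < ‖f x‖ₑ) => ?_)
        exact ENNReal.rpow_le_rpow hx.le hp.le
    _ ≤ ∫⁻ x, ‖f x‖ₑ ^ p ∂μ := mul_meas_ge_le_lintegral₀ (hf.enorm.pow_const p) _

lemma rearrangement_comp_smul {V : Type*} [NormedAddCommGroup V] [NormedSpace ℝ V]
    [FiniteDimensional ℝ V] [MeasurableSpace V] [BorelSpace V] (μ : Measure V) [μ.IsAddHaarMeasure]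
    (f : V → ℂ) {c : ℝ} (hc : 0 < c) (t : ℝ) :
    rearrangement μ (fun x => f (c • x)) t = rearrangement μ f (c ^ finrank ℝ V * t) := by
  have hcn : 0 < c ^ finrank ℝ V := by positivity
  refine eq_of_forall_ge_iff fun τ => ?_
  have hdist : distribution μ (fun x => f (c • x)) τ
      = ENNReal.ofReal (c ^ finrank ℝ V)⁻¹ * distribution μ f τ := by
    have := Measure.addHaar_preimage_smul μ hc.ne' {x | τ < ‖f x‖ₑ}
    rwa [abs_of_pos (inv_pos.mpr hcn)] at this
  rw [rearrangement_le_iff, rearrangement_le_iff, hdist, ENNReal.ofReal_inv_of_pos hcn,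
    ENNReal.ofReal_mul hcn.le, ENNReal.inv_mul_le_iff (by simpa using hcn) (by simp)]

end Rearrangement

section Lorentz

/-- The measure `dt/t` on `(0,∞)`, which is invariant under dilations. -/
def dilationMeasure : Measure ℝ :=
  (volume.restrict (Ioi 0)).withDensity fun t => (ENNReal.ofReal t)⁻¹

lemma lintegral_dilationMeasure {F : ℝ → ℝ≥0∞} (hF : Measurable F) :
    ∫⁻ t, F t ∂dilationMeasure = ∫⁻ t in Ioi 0, F t / ENNReal.ofReal t := by
  rw [dilationMeasure, lintegral_withDensity_eq_lintegral_mul _ (by fun_prop) hF]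
  simp only [Pi.mul_apply, mul_comm, div_eq_mul_inv]

lemma measurePreserving_dilationMeasure {a : ℝ} (ha : 0 < a) :
    MeasurePreserving (a * ·) dilationMeasure dilationMeasure := by
  refine ⟨by fun_prop, Measure.ext_of_lintegral _ fun F hF => ?_⟩
  set G : ℝ → ℝ≥0∞ := (Ioi 0).indicator fun t => F t / ENNReal.ofReal t
  have hG : Measurable G := (by fun_prop : Measurable _).indicator measurableSet_Ioi
  have hscale (t : ℝ) :
      (Ioi 0).indicator (fun t => F (a * t) / ENNReal.ofReal t) t
        = ENNReal.ofReal a * G (a * t) := by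
    by_cases ht : 0 < t
    · have hat : 0 < a * t := mul_pos ha ht
      simp only [G, indicator_of_mem (show t ∈ Ioi 0 from ht),
        indicator_of_mem (show a * t ∈ Ioi 0 from hat)]
      rw [ENNReal.ofReal_mul ha.le, ← mul_div_assoc,
        ENNReal.mul_div_mul_left _ _ (by simpa using ha) (by simp)]
    · have hat : ¬ 0 < a * t := by rwa [mul_pos_iff_of_pos_left ha]
      simp only [G, indicator_of_notMem (show t ∉ Ioi 0 from ht),
        indicator_of_notMem (show a * t ∉ Ioi 0 from hat), mul_zero]
  calc ∫⁻ t, F t ∂dilationMeasure.map (a * ·)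
      = ∫⁻ t, ENNReal.ofReal a * G (a * t) := by
        rw [lintegral_map hF (by fun_prop), lintegral_dilationMeasure (by fun_prop),
          ← lintegral_indicator measurableSet_Ioi]
        exact lintegral_congr hscale
    _ = ∫⁻ t, G t := by
        rw [lintegral_const_mul _ (by fun_prop), ← lintegral_map hG (by fun_prop),
          ← smul_eq_mul, ← lintegral_smul_measure]
        have := Real.smul_map_volume_mul_left ha.ne'
        rw [abs_of_pos ha] at this
        rw [this]
    _ = ∫⁻ t, F t ∂dilationMeasure := by
        rw [lintegral_indicator measurableSet_Ioi, lintegral_dilationMeasure hF]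

lemma ae_dilationMeasure_pos : ∀ᵐ t ∂dilationMeasure, 0 < t :=
  (withDensity_absolutelyContinuous _ _).ae_le (ae_restrict_mem measurableSet_Ioi)

variable {α : Type*} [MeasurableSpace α] {μ : Measure α} {r s : ℝ}

lemma lorentzENorm_eq_eLpNorm (hs : 0 < s) (f : α → ℂ) :
    lorentzENorm μ r s f = eLpNorm (fun t => ENNReal.ofReal (t ^ (1 / r)) * rearrangement μ f t)
      (ENNReal.ofReal s) dilationMeasure := by
  have hmeas := (rearrangement_antitone μ f).measurable
  rw [eLpNorm_eq_lintegral_rpow_enorm_toReal (by simpa using hs) (by simp),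
    ENNReal.toReal_ofReal hs.le, lintegral_dilationMeasure (by simp only [enorm_eq_self]; fun_prop)]
  simp only [enorm_eq_self, lorentzENorm]

lemma eLpNorm_nnreal_smul {ν : Measure α} (hs : 0 < s) {ψ : α → ℝ≥0∞} (hψ : Measurable ψ)
    (c : ℝ≥0) :
    eLpNorm (c • ψ) (ENNReal.ofReal s) ν = c * eLpNorm ψ (ENNReal.ofReal s) ν := by
  simp only [eLpNorm_eq_lintegral_rpow_enorm_toReal (ENNReal.ofReal_pos.mpr hs).ne'
    ENNReal.ofReal_ne_top, ENNReal.toReal_ofReal hs.le, enorm_eq_self, Pi.smul_apply,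
    ENNReal.smul_def, smul_eq_mul, ENNReal.mul_rpow_of_nonneg _ _ hs.le]
  rw [lintegral_const_mul _ (by fun_prop), ENNReal.mul_rpow_of_nonneg _ _ (by positivity),
    one_div, ENNReal.rpow_rpow_inv hs.ne']

lemma eLpNorm_dilationMeasure_comp_mul (hs : 0 < s) {ψ : ℝ → ℝ≥0∞} (hψ : Measurable ψ) {a : ℝ}
    (ha : 0 < a) :
    eLpNorm (fun t => ENNReal.ofReal (t ^ (1 / r)) * ψ (a * t)) (ENNReal.ofReal s) dilationMeasure
      = ENNReal.ofReal (a ^ (-(1 / r))) *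
        eLpNorm (fun t => ENNReal.ofReal (t ^ (1 / r)) * ψ t) (ENNReal.ofReal s)
          dilationMeasure := by
  set Φ : ℝ → ℝ≥0∞ := fun t => ENNReal.ofReal (t ^ (1 / r)) * ψ t
  have hΦ : Measurable Φ := by fun_prop
  have hscale : (fun t => ENNReal.ofReal (t ^ (1 / r)) * ψ (a * t))
      =ᵐ[dilationMeasure] (a ^ (-(1 / r))).toNNReal • (Φ ∘ (a * ·)) := by
    filter_upwards [ae_dilationMeasure_pos] with t ht
    simp only [Φ, Pi.smul_apply, Function.comp_apply, ENNReal.smul_def, smul_eq_mul, ← mul_assoc]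
    congr 1
    change _ = ENNReal.ofReal _ * _
    rw [← ENNReal.ofReal_mul (by positivity), Real.mul_rpow ha.le ht.le, ← mul_assoc,
      ← Real.rpow_add ha, neg_add_cancel, Real.rpow_zero, one_mul]
  rw [eLpNorm_congr_ae hscale, ← eLpNorm_comp_measurePreserving hΦ.aestronglyMeasurable
    (measurePreserving_dilationMeasure ha), eLpNorm_nnreal_smul hs (by fun_prop)]
  rfl

/-- A constant for the quasi-triangle inequality in `L^{r,s}`. -/
def lorentzAddConst (r s : ℝ) : ℝ≥0∞ :=
  LpAddConst (ENNReal.ofReal s) * ENNReal.ofReal (2 ^ (1 / r))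

lemma lorentzAddConst_lt_top : lorentzAddConst r s < ∞ :=
  ENNReal.mul_lt_top (LpAddConst_lt_top _) ENNReal.ofReal_lt_top

lemma lorentzENorm_add_le (hs : 0 < s) (f g : α → ℂ) :
    lorentzENorm μ r s (f + g)
      ≤ lorentzAddConst r s * (lorentzENorm μ r s f + lorentzENorm μ r s g) := by
  have hmeas (h : α → ℂ) := (rearrangement_antitone μ h).measurable
  have hhalf (h : α → ℂ) :
      eLpNorm (fun t => ENNReal.ofReal (t ^ (1 / r)) * rearrangement μ h (2⁻¹ * t))
          (ENNReal.ofReal s) dilationMeasure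
        = ENNReal.ofReal (2 ^ (1 / r)) * lorentzENorm μ r s h := by
    rw [eLpNorm_dilationMeasure_comp_mul hs (hmeas h) (by norm_num), lorentzENorm_eq_eLpNorm hs,
      Real.inv_rpow (by norm_num), Real.rpow_neg (by norm_num), inv_inv]
  rw [lorentzAddConst, mul_assoc, mul_add, ← hhalf, ← hhalf, lorentzENorm_eq_eLpNorm hs]
  refine le_trans (eLpNorm_mono_enorm_ae ?_) (eLpNorm_add_le' ?_ ?_ _)
  · filter_upwards [ae_dilationMeasure_pos] with t ht
    simp only [enorm_eq_self, Pi.add_apply, ← mul_add, inv_mul_eq_div]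
    gcongr
    exact rearrangement_add_le μ f g ht.le
  all_goals
    have := hmeas f
    have := hmeas g
    exact Measurable.aestronglyMeasurable (by fun_prop)

lemma lorentzENorm_comp_smul {V : Type*} [NormedAddCommGroup V] [NormedSpace ℝ V]
    [FiniteDimensional ℝ V] [MeasurableSpace V] [BorelSpace V] (μ : Measure V) [μ.IsAddHaarMeasure]
    (hs : 0 < s) (f : V → ℂ) {c : ℝ} (hc : 0 < c) :
    lorentzENorm μ r s (fun x => f (c • x))
      = ENNReal.ofReal ((c ^ finrank ℝ V) ^ (-(1 / r))) * lorentzENorm μ r s f := by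
  simp only [lorentzENorm_eq_eLpNorm hs, rearrangement_comp_smul μ f hc]
  exact eLpNorm_dilationMeasure_comp_mul hs (rearrangement_antitone μ f).measurable (by positivity)

lemma lorentzENorm_rpow (hs : 0 < s) (f : α → ℂ) :
    lorentzENorm μ r s f ^ s = ∫⁻ t in Ioi (0 : ℝ),
      (ENNReal.ofReal (t ^ (1 / r)) * rearrangement μ f t) ^ s / ENNReal.ofReal t := by
  rw [lorentzENorm, one_div s, ENNReal.rpow_inv_rpow hs.ne']

lemma tsum_le_lorentzENorm_rpow {ι : Type*} [Countable ι] (hr : 0 < r) (hs : 0 < s) {f : α → ℂ}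
    {E : ι → Set α} {t : ι → ℝ} {b : ι → ℝ≥0∞} (ht : ∀ i, 0 < t i)
    (hdisj : Pairwise (Function.onFun Disjoint fun i => Ico (t i / 2) (t i)))
    (hE : ∀ i, ENNReal.ofReal (t i) ≤ μ (E i)) (hb : ∀ i, ∀ x ∈ E i, b i ≤ ‖f x‖ₑ) :
    ∑' i, (ENNReal.ofReal ((t i / 2) ^ (1 / r)) * b i) ^ s ≤ 2 * lorentzENorm μ r s f ^ s := by
  set F : ℝ → ℝ≥0∞ := fun u =>
    (ENNReal.ofReal (u ^ (1 / r)) * rearrangement μ f u) ^ s / ENNReal.ofReal u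
  have hlower (i : ι) : (ENNReal.ofReal ((t i / 2) ^ (1 / r)) * b i) ^ s / 2
      ≤ ∫⁻ u in Ico (t i / 2) (t i), F u := by
    have hti := ht i
    calc (ENNReal.ofReal ((t i / 2) ^ (1 / r)) * b i) ^ s / 2
        = ∫⁻ _ in Ico (t i / 2) (t i),
            (ENNReal.ofReal ((t i / 2) ^ (1 / r)) * b i) ^ s / ENNReal.ofReal (t i) := by
          have hhalf : t i - t i / 2 = t i * 2⁻¹ := by ring
          rw [setLIntegral_const, Real.volume_Ico, hhalf, ENNReal.ofReal_mul hti.le, ← mul_assoc,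
            ENNReal.div_mul_cancel (by simpa using hti) (by simp), div_eq_mul_inv,
            ENNReal.ofReal_inv_of_pos two_pos, ENNReal.ofReal_ofNat]
      _ ≤ ∫⁻ u in Ico (t i / 2) (t i), F u := by
          refine setLIntegral_mono' measurableSet_Ico fun u hu => ?_
          have hbu : b i ≤ rearrangement μ f u :=
            le_rearrangement (((ENNReal.ofReal_lt_ofReal_iff hti).mpr hu.2).trans_le (hE i)) (hb i)
          have hu1 := hu.1
          have hu2 := hu.2.le
          simp only [F]
          gcongr
  calc ∑' i, (ENNReal.ofReal ((t i / 2) ^ (1 / r)) * b i) ^ s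
      = 2 * ∑' i, (ENNReal.ofReal ((t i / 2) ^ (1 / r)) * b i) ^ s / 2 := by
        rw [← ENNReal.tsum_mul_left]
        exact tsum_congr fun i => (ENNReal.mul_div_cancel (by simp) (by simp)).symm
    _ ≤ 2 * ∑' i, ∫⁻ u in Ico (t i / 2) (t i), F u := by gcongr with i; exact hlower i
    _ = 2 * ∫⁻ u in ⋃ i, Ico (t i / 2) (t i), F u := by
        rw [lintegral_iUnion (fun _ => measurableSet_Ico) hdisj]
    _ ≤ 2 * lorentzENorm μ r s f ^ s := by
        rw [lorentzENorm_rpow hs]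
        gcongr
        exact iUnion_subset fun i u hu => (half_pos (ht i)).trans_le hu.1

end Lorentz

section LorentzSpace

variable {α : Type*} [MeasurableSpace α] {μ : Measure α} {r s : ℝ}

lemma lorentzSpace_norm_add_le (hr : 0 < r) (hs : 0 < s) (f g : lorentzSpace μ hr hs) :
    ‖f + g‖ ≤ (lorentzAddConst r s).toNNReal * (‖f‖ + ‖g‖) := by
  have hf : lorentzENorm μ r s (f : α →ₘ[μ] ℂ) ≠ ∞ := f.2.ne
  have hg : lorentzENorm μ r s (g : α →ₘ[μ] ℂ) ≠ ∞ := g.2.ne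
  have hadd : lorentzENorm μ r s ((f + g : lorentzSpace μ hr hs) : α →ₘ[μ] ℂ)
      ≤ lorentzAddConst r s *
        (lorentzENorm μ r s (f : α →ₘ[μ] ℂ) + lorentzENorm μ r s (g : α →ₘ[μ] ℂ)) := by
    rw [Submodule.coe_add, lorentzENorm_congr _ _ (AEEqFun.coeFn_add _ _)]
    exact lorentzENorm_add_le hs _ _
  have hM := (lorentzAddConst_lt_top (r := r) (s := s)).ne
  change _ ≤ (lorentzAddConst r s).toReal * (ENNReal.toReal _ + ENNReal.toReal _)
  rw [← ENNReal.toReal_add hf hg, ← ENNReal.toReal_mul]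
  exact ENNReal.toReal_mono (by finiteness) hadd

lemma exists_linearMap_lorentzSpace {X : Type*} [NormedAddCommGroup X] [NormedSpace ℂ X]
    (hr : 0 < r) (hs : 0 < s) {G : X → α → ℂ} (hmeas : ∀ x, AEStronglyMeasurable (G x) μ)
    (hadd : ∀ x y, G (x + y) =ᵐ[μ] G x + G y) (hsmul : ∀ (c : ℂ) x, G (c • x) =ᵐ[μ] c • G x)
    {C : ℝ≥0} (hC : ∀ x, lorentzENorm μ r s (G x) ≤ C * ‖x‖ₑ) :
    ∃ T : X →ₗ[ℂ] lorentzSpace μ hr hs,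
      IsBoundedOperator T ∧ ∀ x, (T x : α →ₘ[μ] ℂ) =ᵐ[μ] G x := by
  have hcoe (x : X) : AEEqFun.mk (G x) (hmeas x) =ᵐ[μ] G x := AEEqFun.coeFn_mk _ _
  have hle (x : X) : lorentzENorm μ r s (AEEqFun.mk (G x) (hmeas x)) ≤ C * ‖x‖ₑ :=
    (lorentzENorm_congr r s (hcoe x)).trans_le (hC x)
  let T : X →ₗ[ℂ] lorentzSpace μ hr hs :=
    { toFun := fun x => ⟨AEEqFun.mk (G x) (hmeas x), (hle x).trans_lt (by finiteness)⟩
      map_add' := fun x y => Subtype.ext <| AEEqFun.mk_eq_mk.mpr (hadd x y)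
      map_smul' := fun c x => Subtype.ext <| AEEqFun.mk_eq_mk.mpr (hsmul c x) }
  refine ⟨T, ⟨C, fun x => ?_⟩, hcoe⟩
  calc ‖T x‖ ≤ (C * ‖x‖ₑ).toReal := ENNReal.toReal_mono (by finiteness) (hle x)
    _ = C * ‖x‖ := by simp

end LorentzSpace

section StrictlySingular

variable {𝕜 X Y : Type*} [NontriviallyNormedField 𝕜] [NormedAddCommGroup X] [NormedSpace 𝕜 X]
  [AddCommMonoid Y] [Module 𝕜 Y] [Norm Y] {T : X →ₗ[𝕜] Y} {K M : ℝ≥0}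

lemma norm_le_of_mem_closure (hT : IsBoundedOperator T)
    (hY : ∀ y z : Y, ‖y + z‖ ≤ K * (‖y‖ + ‖z‖)) {S : Submodule 𝕜 X}
    (hb : ∀ x ∈ S, ‖x‖ ≤ M * ‖T x‖) {x : X} (hx : x ∈ S.topologicalClosure) :
    ‖x‖ ≤ M * (K * ‖T x‖) := by
  obtain ⟨C, hC⟩ := hT
  have hclosed : IsClosed {y | ‖x‖ ≤ M * (K * (‖T x‖ + C * ‖y - x‖)) + ‖x - y‖} :=
    isClosed_le (by fun_prop) (by fun_prop)
  have hsub : (S : Set X) ⊆ {y | ‖x‖ ≤ M * (K * (‖T x‖ + C * ‖y - x‖)) + ‖x - y‖} := by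
    intro y hy
    calc ‖x‖ ≤ ‖y‖ + ‖x - y‖ := by simpa using norm_add_le y (x - y)
      _ ≤ M * ‖T y‖ + ‖x - y‖ := by gcongr; exact hb y hy
      _ = M * ‖T x + T (y - x)‖ + ‖x - y‖ := by rw [← map_add, add_sub_cancel]
      _ ≤ M * (K * (‖T x‖ + ‖T (y - x)‖)) + ‖x - y‖ := by gcongr; exact hY _ _
      _ ≤ M * (K * (‖T x‖ + C * ‖y - x‖)) + ‖x - y‖ := by gcongr; exact hC _
  simpa using closure_minimal hsub hclosed hx

lemma not_finiteDimensional_topologicalClosure_span {ι : Type*} [Infinite ι] {u : ι → X}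
    (hu : LinearIndependent 𝕜 u) :
    ¬ FiniteDimensional 𝕜 (Submodule.span 𝕜 (range u)).topologicalClosure := by
  intro hfin
  have hmem (i : ι) : u i ∈ (Submodule.span 𝕜 (range u)).topologicalClosure :=
    Submodule.le_topologicalClosure _ (Submodule.subset_span ⟨i, rfl⟩)
  have hli : LinearIndependent 𝕜
      fun i => (⟨u i, hmem i⟩ : (Submodule.span 𝕜 (range u)).topologicalClosure) :=
    LinearIndependent.of_comp (Submodule.subtype _) hu
  exact hli.finite.false

theorem not_isStrictlySingular_of_norm_le {ι : Type*} [Infinite ι] (hT : IsBoundedOperator T)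
    (hY : ∀ y z : Y, ‖y + z‖ ≤ K * (‖y‖ + ‖z‖)) {u : ι → X} (hu : LinearIndependent 𝕜 u)
    (hb : ∀ x ∈ Submodule.span 𝕜 (range u), ‖x‖ ≤ M * ‖T x‖) :
    ¬ IsStrictlySingular T := by
  intro hT'
  obtain ⟨x, hx, hx1, hTx⟩ := hT' _ (Submodule.isClosed_topologicalClosure _)
    (not_finiteDimensional_topologicalClosure_span hu) (1 / (M * K + 1)) (by positivity)
  have hlt : (1 : ℝ) < 1 :=
    calc (1 : ℝ) = ‖x‖ := hx1.symm
      _ ≤ M * (K * ‖T x‖) := norm_le_of_mem_closure hT hY hb hx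
      _ ≤ M * (K * (1 / (M * K + 1))) := by gcongr
      _ = M * K / (M * K + 1) := by ring
      _ < 1 := (div_lt_one (by positivity)).mpr (lt_add_one _)
  exact hlt.false

end StrictlySingular

section Interpolation

variable {α β : Type*} [MeasurableSpace α] [MeasurableSpace β] {μ : Measure α} {ν : Measure β}
  {F : β → ℝ≥0∞} {p : ℝ}

lemma lintegral_rpow_eq_lintegral_measure_lt (hF : AEMeasurable F ν) (hfin : ∀ᵐ x ∂ν, F x ≠ ∞)
    (hp : 0 < p) :
    ∫⁻ x, F x ^ p ∂ν = ENNReal.ofReal p *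
      ∫⁻ l in Ioi (0 : ℝ), ν {x | ENNReal.ofReal l < F x} * ENNReal.ofReal (l ^ (p - 1)) := by
  calc ∫⁻ x, F x ^ p ∂ν
      = ∫⁻ x, ENNReal.ofReal ((F x).toReal ^ p) ∂ν := by
        refine lintegral_congr_ae ?_
        filter_upwards [hfin] with x hx
        rw [← ENNReal.ofReal_rpow_of_nonneg ENNReal.toReal_nonneg hp.le, ENNReal.ofReal_toReal hx]
    _ = ENNReal.ofReal p *
          ∫⁻ l in Ioi 0, ν {x | l < (F x).toReal} * ENNReal.ofReal (l ^ (p - 1)) :=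
        lintegral_rpow_eq_lintegral_meas_lt_mul ν (ae_of_all _ fun _ => ENNReal.toReal_nonneg)
          hF.ennreal_toReal hp
    _ = _ := by
        congr 1
        refine setLIntegral_congr_fun measurableSet_Ioi fun l hl => ?_
        congr 1
        refine measure_congr ?_
        filter_upwards [hfin] with x hx
        exact propext (ENNReal.ofReal_lt_iff_lt_toReal (le_of_lt hl) hx).symm

/-- The mass `∫_{F > l} F dν` of the part of `F` above height `l`. -/
def massAbove (ν : Measure β) (F : β → ℝ≥0∞) (l : ℝ) : ℝ≥0∞ :=
  ∫⁻ x in {x | ENNReal.ofReal l < F x}, F x ∂ν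

/-- The energy `∫_{F ≤ l} F² dν` of the part of `F` below height `l`. -/
def energyBelow (ν : Measure β) (F : β → ℝ≥0∞) (l : ℝ) : ℝ≥0∞ :=
  ∫⁻ x in {x | F x ≤ ENNReal.ofReal l}, F x ^ (2 : ℝ) ∂ν

lemma massAbove_antitone : Antitone (massAbove ν F) := fun _ _ hab =>
  lintegral_mono_set fun _ hx => (ENNReal.ofReal_le_ofReal hab).trans_lt hx

lemma massAbove_le (hF : Measurable F) (hp : 1 ≤ p) (l : ℝ) :
    ENNReal.ofReal l ^ (p - 1) * massAbove ν F l ≤ ∫⁻ x, F x ^ p ∂ν := by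
  have hp1 : 0 ≤ p - 1 := sub_nonneg.mpr hp
  rw [massAbove, ← lintegral_const_mul _ hF]
  refine (setLIntegral_mono (by fun_prop) fun x hx => ?_).trans (setLIntegral_le_lintegral _ _)
  calc ENNReal.ofReal l ^ (p - 1) * F x ≤ F x ^ (p - 1) * F x ^ (1 : ℝ) := by
        rw [ENNReal.rpow_one]
        gcongr
        exact le_of_lt hx
    _ = F x ^ p := by rw [← ENNReal.rpow_add_of_nonneg _ _ hp1 zero_le_one, sub_add_cancel]

lemma energyBelow_le (hF : Measurable F) (hp0 : 0 ≤ p) (hp2 : p ≤ 2) (l : ℝ) :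
    energyBelow ν F l ≤ ENNReal.ofReal l ^ (2 - p) * ∫⁻ x, F x ^ p ∂ν := by
  have hp2' : 0 ≤ 2 - p := sub_nonneg.mpr hp2
  rw [energyBelow, ← lintegral_const_mul _ (by fun_prop)]
  refine (setLIntegral_mono (by fun_prop) fun x hx => ?_).trans (setLIntegral_le_lintegral _ _)
  calc F x ^ (2 : ℝ) = F x ^ (2 - p) * F x ^ p := by
        rw [← ENNReal.rpow_add_of_nonneg _ _ hp2' hp0, sub_add_cancel]
    _ ≤ ENNReal.ofReal l ^ (2 - p) * F x ^ p := by gcongr; exact hx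

lemma massAbove_lt_top (hF : Measurable F) (hp : 1 ≤ p) (hI : ∫⁻ x, F x ^ p ∂ν < ∞) {l : ℝ}
    (hl : 0 < l) : massAbove ν F l < ∞ := by
  have hne : ENNReal.ofReal l ^ (p - 1) ≠ 0 :=
    (ENNReal.rpow_pos (ENNReal.ofReal_pos.mpr hl) ENNReal.ofReal_ne_top).ne'
  exact ENNReal.lt_top_of_mul_ne_top_right ((massAbove_le hF hp l).trans_lt hI).ne hne

lemma energyBelow_lt_top (hF : Measurable F) (hp0 : 0 ≤ p) (hp2 : p ≤ 2)
    (hI : ∫⁻ x, F x ^ p ∂ν < ∞) (l : ℝ) : energyBelow ν F l < ∞ :=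
  (energyBelow_le hF hp0 hp2 l).trans_lt <| ENNReal.mul_lt_top
    (ENNReal.rpow_lt_top_of_nonneg (sub_nonneg.mpr hp2) ENNReal.ofReal_ne_top) hI

lemma ofReal_mul_lintegral_massAbove (hF : Measurable F) (hfin : ∀ᵐ x ∂ν, F x ≠ ∞) (hp : 1 < p) :
    ENNReal.ofReal (p - 1) *
      ∫⁻ l in Ioi (0 : ℝ), massAbove ν F l * ENNReal.ofReal (l ^ (p - 2)) = ∫⁻ x, F x ^ p ∂ν := by
  have hp1 : 0 < p - 1 := sub_pos.mpr hp
  have hlayer := lintegral_rpow_eq_lintegral_measure_lt (ν := ν.withDensity F) hF.aemeasurable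
    ((withDensity_absolutelyContinuous _ _).ae_le hfin) hp1
  rw [lintegral_withDensity_eq_lintegral_mul _ hF (by fun_prop)] at hlayer
  have hexp : p - 1 - 1 = p - 2 := by ring
  simp only [withDensity_apply F (measurableSet_lt measurable_const hF), hexp, Pi.mul_apply]
    at hlayer
  simp only [massAbove]
  rw [← hlayer]
  refine lintegral_congr fun x => ?_
  nth_rw 1 [← ENNReal.rpow_one (F x)]
  rw [← ENNReal.rpow_add_of_nonneg _ _ zero_le_one hp1.le, add_sub_cancel]

lemma lintegral_Ioi_rpow {a y : ℝ} (ha : a < -1) (hy : 0 < y) :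
    ∫⁻ l in Ioi y, ENNReal.ofReal (l ^ a) = ENNReal.ofReal (y ^ (a + 1) / (-a - 1)) := by
  rw [← ofReal_integral_eq_lintegral_ofReal (integrableOn_Ioi_rpow_of_lt ha hy),
    integral_Ioi_rpow_of_lt ha hy]
  · congr 1
    rw [← neg_div_neg_eq, neg_neg, neg_add']
  · filter_upwards [ae_restrict_mem measurableSet_Ioi] with l hl
    exact Real.rpow_nonneg (hy.trans hl).le a

lemma lintegral_Ioi_indicator_rpow {c : ℝ≥0∞} (hc : c ≠ ∞) (hp0 : 0 < p) (hp2 : p < 2) :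
    ∫⁻ l in Ioi (0 : ℝ), {l : ℝ | c ≤ ENNReal.ofReal l}.indicator
        (fun l => c ^ (2 : ℝ) * ENNReal.ofReal (l ^ (p - 3))) l
      = c ^ p / ENNReal.ofReal (2 - p) := by
  rcases eq_or_ne c 0 with rfl | hc0
  · simp [hp0]
  have hy : 0 < c.toReal := ENNReal.toReal_pos hc0 hc
  have hset : {l : ℝ | c ≤ ENNReal.ofReal l} ∩ Ioi 0 = Ici c.toReal := by
    ext l
    exact ⟨fun ⟨hcl, hl⟩ => (ENNReal.le_ofReal_iff_toReal_le hc (le_of_lt hl)).mp hcl,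
      fun hl => ⟨(ENNReal.le_ofReal_iff_toReal_le hc (hy.le.trans hl)).mpr hl, hy.trans_le hl⟩⟩
  rw [setLIntegral_indicator (measurableSet_le measurable_const (by fun_prop)), hset,
    lintegral_const_mul _ (by fun_prop), setLIntegral_congr Ioi_ae_eq_Ici.symm,
    lintegral_Ioi_rpow (by linarith) hy, ← ENNReal.ofReal_toReal hc,
    ENNReal.ofReal_rpow_of_pos hy, ENNReal.ofReal_rpow_of_pos hy,
    ← ENNReal.ofReal_mul (by positivity), ← ENNReal.ofReal_div_of_pos (by linarith),
    ENNReal.toReal_ofReal hy.le, ← mul_div_assoc, ← Real.rpow_add hy]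
  ring_nf

lemma ofReal_mul_lintegral_energyBelow [SFinite ν] (hF : Measurable F) (hfin : ∀ᵐ x ∂ν, F x ≠ ∞)
    (hp0 : 0 < p) (hp2 : p < 2) :
    ENNReal.ofReal (2 - p) *
      ∫⁻ l in Ioi (0 : ℝ), energyBelow ν F l * ENNReal.ofReal (l ^ (p - 3))
        = ∫⁻ x, F x ^ p ∂ν := by
  have hmeas : MeasurableSet {z : ℝ × β | F z.2 ≤ ENNReal.ofReal z.1} :=
    measurableSet_le (by fun_prop) (by fun_prop)
  have hswap : ∫⁻ l in Ioi (0 : ℝ), energyBelow ν F l * ENNReal.ofReal (l ^ (p - 3))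
      = ∫⁻ x, (∫⁻ l in Ioi (0 : ℝ), {l : ℝ | F x ≤ ENNReal.ofReal l}.indicator
          (fun l => F x ^ (2 : ℝ) * ENNReal.ofReal (l ^ (p - 3))) l) ∂ν := by
    rw [← lintegral_lintegral_swap]
    · refine lintegral_congr fun l => ?_
      rw [energyBelow, ← lintegral_mul_const _ (by fun_prop),
        ← lintegral_indicator (measurableSet_le hF measurable_const)]
      rfl
    · exact ((by fun_prop : Measurable fun z : ℝ × β =>
        F z.2 ^ (2 : ℝ) * ENNReal.ofReal (z.1 ^ (p - 3))).indicator hmeas).aemeasurable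
  rw [hswap, ← lintegral_const_mul' _ _ (by simp)]
  refine lintegral_congr_ae ?_
  filter_upwards [hfin] with x hx
  rw [lintegral_Ioi_indicator_rpow hx hp0 hp2,
    ENNReal.mul_div_cancel (by simpa using hp2) (by simp)]

/-- The measure `dt/t²` on `(0,∞)`: for `r = s'`, `∫ (t^{1/r} g^*)^s dt/t = ∫ (t g^*)^s dt/t²`. -/
def invSqMeasure : Measure ℝ :=
  (volume.restrict (Ioi 0)).withDensity fun t => ENNReal.ofReal (t ^ (-2 : ℝ))

lemma invSqMeasure_setOf_lt_mul_le {y : ℝ} (hy : 0 < y) (c : ℝ≥0∞) :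
    invSqMeasure {t | ENNReal.ofReal y < ENNReal.ofReal t * c} ≤ c / ENNReal.ofReal y := by
  rcases eq_or_ne c ∞ with rfl | hc
  · simp [ENNReal.top_div]
  rcases eq_or_ne c 0 with rfl | hc0
  · simp
  have hc' : 0 < c.toReal := ENNReal.toReal_pos hc0 hc
  have hsub : {t | ENNReal.ofReal y < ENNReal.ofReal t * c} ⊆ Ioi (y / c.toReal) := by
    intro t ht
    rw [mem_ofPred_eq, ← ENNReal.ofReal_toReal hc, ← ENNReal.ofReal_mul' hc'.le,
      ENNReal.ofReal_lt_ofReal_iff_of_nonneg hy.le] at ht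
    exact (div_lt_iff₀ hc').mpr ht
  calc invSqMeasure {t | ENNReal.ofReal y < ENNReal.ofReal t * c}
      ≤ invSqMeasure (Ioi (y / c.toReal)) := measure_mono hsub
    _ ≤ ∫⁻ t in Ioi (y / c.toReal), ENNReal.ofReal (t ^ (-2 : ℝ)) := by
        rw [invSqMeasure, withDensity_apply _ measurableSet_Ioi]
        exact lintegral_mono' (Measure.restrict_mono le_rfl Measure.restrict_le_self) le_rfl
    _ = ENNReal.ofReal (c.toReal / y) := by
        rw [lintegral_Ioi_rpow (by norm_num) (by positivity)]
        norm_num [Real.rpow_neg_one]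
    _ = c / ENNReal.ofReal y := by rw [ENNReal.ofReal_div_of_pos hy, ENNReal.ofReal_toReal hc]

/-- A function `g` on `(α, μ)` satisfies the estimate
`g^*(t) ≤ ∫_{F > l} F + (t⁻¹ ∫_{F ≤ l} F²)^{1/2}`, for all `l, t > 0`, of an image of `F` under an
operator of norm at most `1` from `L¹` to `L^∞` and from `L²` to `L²`. -/
def RearrangementControlled (μ : Measure α) (ν : Measure β) (g : α → ℂ) (F : β → ℝ≥0∞) : Prop :=
  ∀ l t : ℝ, 0 < l → 0 < t → rearrangement μ g t ≤
    massAbove ν F l + (energyBelow ν F l / ENNReal.ofReal t) ^ (1 / 2 : ℝ)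

variable {g : α → ℂ}

lemma two_mul_mul_div_rpow_half {x : ℝ≥0∞} (hx0 : x ≠ 0) (hx : x ≠ ∞) (y : ℝ≥0∞) :
    2 * (x * (y / x) ^ (1 / 2 : ℝ)) = (x * (4 * y)) ^ (1 / 2 : ℝ) := by
  have hsq : x * (4 * y) = (2 * x) ^ (2 : ℝ) * (y / x) := by
    calc x * (4 * y) = 4 * x * (x * (y / x)) := by rw [ENNReal.mul_div_cancel hx0 hx]; ring
      _ = (2 * x) ^ (2 : ℝ) * (y / x) := by rw [ENNReal.rpow_two]; ring
  rw [hsq, ENNReal.mul_rpow_of_nonneg _ _ (by norm_num), ← ENNReal.rpow_mul]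
  norm_num [mul_assoc]

lemma RearrangementControlled.invSqMeasure_le (h : RearrangementControlled μ ν g F) {l : ℝ}
    (hl : 0 < l) :
    invSqMeasure {t | ENNReal.ofReal l < ENNReal.ofReal t * rearrangement μ g t} ≤
      2 * massAbove ν F l / ENNReal.ofReal l
        + 4 * energyBelow ν F l / ENNReal.ofReal (l ^ 2) := by
  set A := massAbove ν F l
  set B := energyBelow ν F l
  have hsub : {t | ENNReal.ofReal l < ENNReal.ofReal t * rearrangement μ g t}
      ⊆ {t | ENNReal.ofReal l < ENNReal.ofReal t * (2 * A)}
        ∪ {t | ENNReal.ofReal (l ^ 2) < ENNReal.ofReal t * (4 * B)} := by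
    intro t ht
    by_contra! hcon
    simp only [mem_union, mem_ofPred_eq, not_or, not_lt] at hcon ht
    obtain ⟨hA, hB⟩ := hcon
    have ht0 : 0 < t := by
      by_contra! hle
      simp [ENNReal.ofReal_of_nonpos hle] at ht
    have hsqrt : 2 * (ENNReal.ofReal t * (B / ENNReal.ofReal t) ^ (1 / 2 : ℝ)) ≤ ENNReal.ofReal l :=
      calc 2 * (ENNReal.ofReal t * (B / ENNReal.ofReal t) ^ (1 / 2 : ℝ))
          = (ENNReal.ofReal t * (4 * B)) ^ (1 / 2 : ℝ) :=
            two_mul_mul_div_rpow_half (ENNReal.ofReal_pos.mpr ht0).ne' ENNReal.ofReal_ne_top B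
        _ ≤ ENNReal.ofReal (l ^ 2) ^ (1 / 2 : ℝ) := by gcongr
        _ = ENNReal.ofReal l := by
            rw [ENNReal.ofReal_rpow_of_pos (by positivity), ← Real.sqrt_eq_rpow, Real.sqrt_sq hl.le]
    refine ht.not_ge ((ENNReal.mul_le_mul_iff_right two_ne_zero ofNat_ne_top).mp ?_)
    calc 2 * (ENNReal.ofReal t * rearrangement μ g t)
        ≤ 2 * (ENNReal.ofReal t * (A + (B / ENNReal.ofReal t) ^ (1 / 2 : ℝ))) := by
          gcongr
          exact h l t hl ht0
      _ = ENNReal.ofReal t * (2 * A)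
            + 2 * (ENNReal.ofReal t * (B / ENNReal.ofReal t) ^ (1 / 2 : ℝ)) := by ring
      _ ≤ ENNReal.ofReal l + ENNReal.ofReal l := add_le_add hA hsqrt
      _ = 2 * ENNReal.ofReal l := (two_mul _).symm
  refine (measure_mono hsub).trans ((measure_union_le _ _).trans (add_le_add ?_ ?_))
  · exact invSqMeasure_setOf_lt_mul_le hl _
  · exact invSqMeasure_setOf_lt_mul_le (by positivity) _

lemma RearrangementControlled.rearrangement_lt_top (h : RearrangementControlled μ ν g F)
    (hF : Measurable F) (hp1 : 1 ≤ p) (hp2 : p ≤ 2) (hI : ∫⁻ x, F x ^ p ∂ν < ∞) {t : ℝ}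
    (ht : 0 < t) : rearrangement μ g t < ∞ := by
  have hA := massAbove_lt_top hF hp1 hI one_pos
  have hB := energyBelow_lt_top hF (zero_le_one.trans hp1) hp2 hI 1
  refine (h 1 t one_pos ht).trans_lt (ENNReal.add_lt_top.mpr ⟨hA, ?_⟩)
  exact ENNReal.rpow_lt_top_of_nonneg (by norm_num)
    (ENNReal.div_lt_top hB.ne (ENNReal.ofReal_pos.mpr ht).ne').ne

lemma lorentzENorm_rpow_eq_lintegral_invSqMeasure {p' : ℝ} (hpp' : p.HolderConjugate p')
    (g : α → ℂ) :
    lorentzENorm μ p' p g ^ p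
      = ∫⁻ t, (ENNReal.ofReal t * rearrangement μ g t) ^ p ∂invSqMeasure := by
  have := (rearrangement_antitone μ g).measurable
  rw [lorentzENorm_rpow hpp'.pos, invSqMeasure,
    lintegral_withDensity_eq_lintegral_mul _ (by fun_prop) (by fun_prop)]
  refine setLIntegral_congr_fun measurableSet_Ioi fun t (ht : 0 < t) => ?_
  have hp0 := hpp'.pos
  have hexp : 1 / p' * p = p - 1 := by rw [one_div_mul_eq_div, hpp'.div_conj_eq_sub_one]
  have hpow : (t ^ (1 / p')) ^ p / t = t ^ (-2 : ℝ) * t ^ p := by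
    rw [← Real.rpow_mul ht.le, hexp, ← Real.rpow_sub_one ht.ne', ← Real.rpow_add ht]
    ring_nf
  simp only [Pi.mul_apply]
  rw [ENNReal.mul_rpow_of_nonneg _ _ hp0.le, ENNReal.mul_rpow_of_nonneg _ _ hp0.le, ← mul_assoc,
    ENNReal.ofReal_rpow_of_pos (by positivity), ENNReal.ofReal_rpow_of_pos ht,
    ← ENNReal.ofReal_mul (by positivity), ← hpow, ENNReal.ofReal_div_of_pos ht,
    ENNReal.mul_div_right_comm]

lemma RearrangementControlled.invSqMeasure_mul_le (h : RearrangementControlled μ ν g F) {l : ℝ}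
    (hl : 0 < l) :
    invSqMeasure {t | ENNReal.ofReal l < ENNReal.ofReal t * rearrangement μ g t}
        * ENNReal.ofReal (l ^ (p - 1)) ≤
      2 * (massAbove ν F l * ENNReal.ofReal (l ^ (p - 2)))
        + 4 * (energyBelow ν F l * ENNReal.ofReal (l ^ (p - 3))) := by
  have hdiv {a b : ℝ} (hb : 0 < b) (x : ℝ≥0∞) :
      x / ENNReal.ofReal b * ENNReal.ofReal a = x * ENNReal.ofReal (a / b) := by
    rw [ENNReal.ofReal_div_of_pos hb, ENNReal.mul_comm_div]
  have hexp1 : l ^ (p - 1) / l = l ^ (p - 2) := by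
    rw [← Real.rpow_sub_one hl.ne']
    ring_nf
  have hexp2 : l ^ (p - 1) / l ^ 2 = l ^ (p - 3) := by
    rw [← Real.rpow_sub_natCast hl.ne']
    ring_nf
  calc invSqMeasure {t | ENNReal.ofReal l < ENNReal.ofReal t * rearrangement μ g t}
        * ENNReal.ofReal (l ^ (p - 1))
      ≤ (2 * massAbove ν F l / ENNReal.ofReal l + 4 * energyBelow ν F l / ENNReal.ofReal (l ^ 2))
          * ENNReal.ofReal (l ^ (p - 1)) := by
        gcongr
        exact h.invSqMeasure_le hl
    _ = _ := by
        rw [add_mul, hdiv hl, hdiv (by positivity), hexp1, hexp2, mul_assoc, mul_assoc]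

lemma RearrangementControlled.lorentzENorm_rpow_eq (h : RearrangementControlled μ ν g F)
    (hF : Measurable F) {p' : ℝ} (hpp' : p.HolderConjugate p') (hp2 : p ≤ 2)
    (hI : ∫⁻ x, F x ^ p ∂ν < ∞) :
    lorentzENorm μ p' p g ^ p = ENNReal.ofReal p * ∫⁻ l in Ioi (0 : ℝ),
      invSqMeasure {t | ENNReal.ofReal l < ENNReal.ofReal t * rearrangement μ g t}
        * ENNReal.ofReal (l ^ (p - 1)) := by
  have hmeas : Measurable fun t => ENNReal.ofReal t * rearrangement μ g t := by
    have := (rearrangement_antitone μ g).measurable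
    fun_prop
  have hfin : ∀ᵐ t ∂invSqMeasure, ENNReal.ofReal t * rearrangement μ g t ≠ ∞ := by
    refine (withDensity_absolutelyContinuous _ _).ae_le ?_
    filter_upwards [ae_restrict_mem measurableSet_Ioi] with t ht
    exact ENNReal.mul_ne_top ENNReal.ofReal_ne_top
      (h.rearrangement_lt_top hF hpp'.lt.le hp2 hI ht).ne
  rw [lorentzENorm_rpow_eq_lintegral_invSqMeasure hpp',
    lintegral_rpow_eq_lintegral_measure_lt hmeas.aemeasurable hfin hpp'.pos]

/-- A constant for the Paley inequality `‖g‖_{p',p}^p ≤ C ∫ F^p`. -/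
def paleyConst (p : ℝ) : ℝ≥0∞ :=
  ENNReal.ofReal p * (2 / ENNReal.ofReal (p - 1) + 4 / ENNReal.ofReal (2 - p))

lemma paleyConst_lt_top (hp1 : 1 < p) (hp2 : p < 2) : paleyConst p < ∞ := by
  refine ENNReal.mul_lt_top ENNReal.ofReal_lt_top (ENNReal.add_lt_top.mpr ⟨?_, ?_⟩)
  · exact ENNReal.div_lt_top (by simp) (by simpa using hp1)
  · exact ENNReal.div_lt_top (by simp) (by simpa using hp2)

lemma RearrangementControlled.lorentzENorm_rpow_le [SFinite ν] {p' : ℝ}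
    (h : RearrangementControlled μ ν g F) (hF : Measurable F) (hpp' : p.HolderConjugate p')
    (hp2 : p < 2) (hI : ∫⁻ x, F x ^ p ∂ν < ∞) :
    lorentzENorm μ p' p g ^ p ≤ paleyConst p * ∫⁻ x, F x ^ p ∂ν := by
  have hfin : ∀ᵐ x ∂ν, F x ≠ ∞ := by
    filter_upwards [ae_lt_top (hF.pow_const p) hI.ne] with x hx
    exact ((ENNReal.rpow_lt_top_iff_of_pos hpp'.pos).mp hx).ne
  have hA := ofReal_mul_lintegral_massAbove hF hfin hpp'.lt
  have hB := ofReal_mul_lintegral_energyBelow hF hfin hpp'.pos hp2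
  rw [← ENNReal.eq_div_iff (by simpa using hpp'.lt) (by simp)] at hA
  rw [← ENNReal.eq_div_iff (by simpa using hp2) (by simp)] at hB
  have hmass : Measurable (massAbove ν F) := massAbove_antitone.measurable
  rw [h.lorentzENorm_rpow_eq hF hpp' hp2.le hI, paleyConst, mul_assoc]
  gcongr
  calc ∫⁻ l in Ioi (0 : ℝ),
          invSqMeasure {t | ENNReal.ofReal l < ENNReal.ofReal t * rearrangement μ g t}
            * ENNReal.ofReal (l ^ (p - 1))
      ≤ ∫⁻ l in Ioi (0 : ℝ), (2 * (massAbove ν F l * ENNReal.ofReal (l ^ (p - 2)))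
            + 4 * (energyBelow ν F l * ENNReal.ofReal (l ^ (p - 3)))) :=
        setLIntegral_mono' measurableSet_Ioi fun l hl => h.invSqMeasure_mul_le hl
    _ = 2 * ((∫⁻ x, F x ^ p ∂ν) / ENNReal.ofReal (p - 1))
          + 4 * ((∫⁻ x, F x ^ p ∂ν) / ENNReal.ofReal (2 - p)) := by
        rw [lintegral_add_left (by fun_prop), lintegral_const_mul' _ _ (by simp),
          lintegral_const_mul' _ _ (by simp), hA, hB]
    _ = (2 / ENNReal.ofReal (p - 1) + 4 / ENNReal.ofReal (2 - p)) * ∫⁻ x, F x ^ p ∂ν := by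
        simp only [div_eq_mul_inv]
        ring

end Interpolation

section WeakFourierTransform

variable {V : Type*} [NormedAddCommGroup V] [InnerProductSpace ℝ V] [FiniteDimensional ℝ V]
  [MeasurableSpace V] [BorelSpace V]

lemma continuous_fourier_of_integrable {f : V → ℂ} (hf : Integrable f) : Continuous (𝓕 f) :=
  VectorFourier.fourierIntegral_continuous Real.continuous_fourierChar
    (by exact continuous_inner) hf

/-- `g` is the Fourier transform of `f` in the weak sense `∫ φ g = ∫ 𝓕φ f` for all Schwartz `φ`,
with both integrals convergent. -/
structure HasFourierTransform (f g : V → ℂ) : Prop where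
  locallyIntegrable : LocallyIntegrable g
  integrable_smul (φ : 𝓢(V, ℂ)) : Integrable fun x => φ x • g x
  integrable_fourier_smul (φ : 𝓢(V, ℂ)) : Integrable fun x => 𝓕 φ x • f x
  integral_smul_eq (φ : 𝓢(V, ℂ)) : ∫ x, φ x • g x = ∫ x, 𝓕 φ x • f x

namespace HasFourierTransform

variable {f f' g g' : V → ℂ}

lemma congr_left (h : HasFourierTransform f g) (hf : f =ᵐ[volume] f') :
    HasFourierTransform f' g where
  locallyIntegrable := h.locallyIntegrable
  integrable_smul := h.integrable_smul
  integrable_fourier_smul φ := (h.integrable_fourier_smul φ).congr <| by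
    filter_upwards [hf] with x hx using by rw [hx]
  integral_smul_eq φ := (h.integral_smul_eq φ).trans <| integral_congr_ae <| by
    filter_upwards [hf] with x hx using by rw [hx]

lemma add (h : HasFourierTransform f g) (h' : HasFourierTransform f' g') :
    HasFourierTransform (f + f') (g + g') where
  locallyIntegrable := h.locallyIntegrable.add h'.locallyIntegrable
  integrable_smul φ := by
    simp only [Pi.add_apply, smul_add]
    exact (h.integrable_smul φ).add (h'.integrable_smul φ)
  integrable_fourier_smul φ := by
    simp only [Pi.add_apply, smul_add]
    exact (h.integrable_fourier_smul φ).add (h'.integrable_fourier_smul φ)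
  integral_smul_eq φ := by
    simp only [Pi.add_apply, smul_add]
    rw [integral_add (h.integrable_smul φ) (h'.integrable_smul φ),
      integral_add (h.integrable_fourier_smul φ) (h'.integrable_fourier_smul φ),
      h.integral_smul_eq, h'.integral_smul_eq]

lemma const_smul (h : HasFourierTransform f g) (c : ℂ) :
    HasFourierTransform (c • f) (c • g) where
  locallyIntegrable := h.locallyIntegrable.smul c
  integrable_smul φ := by
    simp only [Pi.smul_apply, smul_comm _ c]
    exact (h.integrable_smul φ).smul c
  integrable_fourier_smul φ := by
    simp only [Pi.smul_apply, smul_comm _ c]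
    exact (h.integrable_fourier_smul φ).smul c
  integral_smul_eq φ := by
    simp only [Pi.smul_apply, smul_comm _ c, integral_smul, h.integral_smul_eq]

lemma unique (h : HasFourierTransform f g) (h' : HasFourierTransform f g') : g =ᵐ[volume] g' := by
  refine ae_eq_of_integral_contDiff_smul_eq h.locallyIntegrable h'.locallyIntegrable
    fun θ hθ hθc => ?_
  have hsupp : HasCompactSupport (Complex.ofRealCLM ∘ θ) := hθc.comp_left rfl
  have hsmooth : ContDiff ℝ (⊤ : ℕ∞) (Complex.ofRealCLM ∘ θ) := by fun_prop
  have htest := (h.integral_smul_eq (hsupp.toSchwartzMap hsmooth)).trans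
    (h'.integral_smul_eq (hsupp.toSchwartzMap hsmooth)).symm
  simpa using htest

lemma of_integrable (hf : Integrable f) : HasFourierTransform f (𝓕 f) where
  locallyIntegrable := (continuous_fourier_of_integrable hf).locallyIntegrable
  integrable_smul φ := φ.integrable.mul_bdd
    (continuous_fourier_of_integrable hf).aestronglyMeasurable
    (ae_of_all _ fun x => VectorFourier.norm_fourierIntegral_le_integral_norm _ _ _ f x)
  integrable_fourier_smul φ :=
    ((𝓕 φ).memLp ∞ volume).integrable_mul (memLp_one_iff_integrable.mpr hf)
  integral_smul_eq φ := by
    have hself := VectorFourier.integral_fourierIntegral_smul_eq_flip (L := innerₗ V)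
      Real.continuous_fourierChar (by exact continuous_inner) (φ.integrable (μ := volume)) hf
    rw [flip_innerₗ] at hself
    rw [SchwartzMap.fourier_coe]
    exact hself.symm

lemma of_lp_two (f : Lp ℂ 2 (volume : Measure V)) :
    HasFourierTransform f (𝓕 f : Lp ℂ 2 (volume : Measure V)) where
  locallyIntegrable := (Lp.memLp (𝓕 f)).locallyIntegrable one_le_two
  integrable_smul φ := (φ.memLp 2 volume).integrable_mul (Lp.memLp (𝓕 f))
  integrable_fourier_smul φ := ((𝓕 φ).memLp 2 volume).integrable_mul (Lp.memLp f)
  integral_smul_eq φ := by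
    rw [← Lp.toTemperedDistribution_apply, ← Lp.fourier_toTemperedDistribution_eq,
      TemperedDistribution.fourier_apply, Lp.toTemperedDistribution_apply]

end HasFourierTransform

lemma lintegral_enorm_fourier_rpow_two (f : Lp ℂ 2 (volume : Measure V)) :
    ∫⁻ x, ‖(𝓕 f : Lp ℂ 2 (volume : Measure V)) x‖ₑ ^ (2 : ℝ) = ∫⁻ x, ‖f x‖ₑ ^ (2 : ℝ) := by
  have hnorm : eLpNorm (𝓕 f : Lp ℂ 2 (volume : Measure V)) 2 volume = eLpNorm f 2 volume := by
    rw [← Lp.enorm_def, ← Lp.enorm_def, ← ofReal_norm, ← ofReal_norm, Lp.norm_fourier_eq]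
  rwa [eLpNorm_eq_lintegral_rpow_enorm_toReal two_ne_zero ofNat_ne_top,
    eLpNorm_eq_lintegral_rpow_enorm_toReal two_ne_zero ofNat_ne_top, ENNReal.toReal_ofNat,
    (ENNReal.rpow_left_injective (by norm_num)).eq_iff] at hnorm

lemma enorm_fourier_le (f : V → ℂ) (x : V) : ‖𝓕 f x‖ₑ ≤ ∫⁻ y, ‖f y‖ₑ :=
  (enorm_integral_le_lintegral_enorm _).trans_eq <|
    lintegral_congr fun _ => by simp [enorm_eq_nnnorm, ← NNReal.coe_inj, Circle.norm_smul]

lemma rearrangement_fourier_add_le (f₁ : V → ℂ) (f₂ : Lp ℂ 2 (volume : Measure V)) {t : ℝ}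
    (ht : 0 < t) :
    rearrangement volume (𝓕 f₁ + ⇑(𝓕 f₂ : Lp ℂ 2 (volume : Measure V))) t ≤
      (∫⁻ x, ‖f₁ x‖ₑ) + ((∫⁻ x, ‖f₂ x‖ₑ ^ (2 : ℝ)) / ENNReal.ofReal t) ^ (1 / 2 : ℝ) := by
  refine (rearrangement_add_le_of_enorm_le (enorm_fourier_le f₁)).trans ?_
  rw [← lintegral_enorm_fourier_rpow_two]
  gcongr
  exact rearrangement_le_of_lintegral two_pos (Lp.aestronglyMeasurable _) ht

section Truncation

variable {f : V → ℂ} {l : ℝ}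

lemma integrable_indicator_lt (hf : Measurable f) (hA : massAbove volume (‖f ·‖ₑ) l < ∞) :
    Integrable ({x | ENNReal.ofReal l < ‖f x‖ₑ}.indicator f) :=
  (integrable_indicator_iff (measurableSet_lt measurable_const hf.enorm)).mpr
    ⟨hf.aestronglyMeasurable, hA⟩

lemma memLp_two_indicator_le (hf : Measurable f) (hB : energyBelow volume (‖f ·‖ₑ) l < ∞) :
    MemLp ({x | ‖f x‖ₑ ≤ ENNReal.ofReal l}.indicator f) 2 := by
  rw [memLp_indicator_iff_restrict (measurableSet_le hf.enorm measurable_const)]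
  refine ⟨hf.aestronglyMeasurable, ?_⟩
  rw [eLpNorm_lt_top_iff_lintegral_rpow_enorm_lt_top two_ne_zero ofNat_ne_top]
  simpa [energyBelow] using hB

lemma exists_hasFourierTransform_of_truncation (hf : Measurable f)
    (hA : massAbove volume (‖f ·‖ₑ) l < ∞) (hB : energyBelow volume (‖f ·‖ₑ) l < ∞) :
    ∃ g, HasFourierTransform f g ∧ ∀ t, 0 < t → rearrangement volume g t ≤
      massAbove volume (‖f ·‖ₑ) l
        + (energyBelow volume (‖f ·‖ₑ) l / ENNReal.ofReal t) ^ (1 / 2 : ℝ) := by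
  set high := {x | ENNReal.ofReal l < ‖f x‖ₑ}.indicator f
  have hhigh : Integrable high := integrable_indicator_lt hf hA
  have hlow := memLp_two_indicator_le hf hB
  set low := hlow.toLp
  have hsum : high + ⇑low =ᵐ[volume] f := by
    have hcompl : {x | ‖f x‖ₑ ≤ ENNReal.ofReal l} = {x | ENNReal.ofReal l < ‖f x‖ₑ}ᶜ := by
      ext x
      exact not_lt (a := ENNReal.ofReal l).symm
    filter_upwards [hlow.coeFn_toLp] with x hx
    rw [Pi.add_apply, hx, hcompl, ← Pi.add_apply, indicator_self_add_compl]
  refine ⟨_, ((HasFourierTransform.of_integrable hhigh).add (.of_lp_two low)).congr_left hsum,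
    fun t ht => (rearrangement_fourier_add_le high low ht).trans_eq ?_⟩
  have hmass : ∫⁻ x, ‖high x‖ₑ = massAbove volume (‖f ·‖ₑ) l := by
    simp_rw [high, enorm_indicator_eq_indicator_enorm]
    exact lintegral_indicator (measurableSet_lt measurable_const hf.enorm) _
  have henergy : ∫⁻ x, ‖low x‖ₑ ^ (2 : ℝ) = energyBelow volume (‖f ·‖ₑ) l := by
    rw [energyBelow, ← lintegral_indicator (measurableSet_le hf.enorm measurable_const)]
    refine lintegral_congr_ae ?_
    filter_upwards [hlow.coeFn_toLp] with x hx
    rw [hx, enorm_indicator_eq_indicator_enorm]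
    exact (congrFun (indicator_comp_of_zero (g := (· ^ (2 : ℝ))) (by simp)) x).symm
  rw [hmass, henergy]

lemma HasFourierTransform.rearrangementControlled {g : V → ℂ} (h : HasFourierTransform f g)
    (hf : Measurable f) {p : ℝ} (hp1 : 1 ≤ p) (hp2 : p ≤ 2) (hI : ∫⁻ x, ‖f x‖ₑ ^ p < ∞) :
    RearrangementControlled volume volume g (‖f ·‖ₑ) := by
  intro l t hl ht
  obtain ⟨k, hk, hkt⟩ := exists_hasFourierTransform_of_truncation hf
    (massAbove_lt_top hf.enorm hp1 hI hl)
    (energyBelow_lt_top hf.enorm (zero_le_one.trans hp1) hp2 hI l)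
  rw [rearrangement_congr (h.unique hk)]
  exact hkt t ht

lemma exists_hasFourierTransform (hf : Measurable f) {p : ℝ} (hp1 : 1 ≤ p) (hp2 : p ≤ 2)
    (hI : ∫⁻ x, ‖f x‖ₑ ^ p < ∞) : ∃ g, HasFourierTransform f g :=
  let ⟨g, hg, _⟩ := exists_hasFourierTransform_of_truncation hf
    (massAbove_lt_top hf.enorm hp1 hI one_pos)
    (energyBelow_lt_top hf.enorm (zero_le_one.trans hp1) hp2 hI 1)
  ⟨g, hg⟩

end Truncation

end WeakFourierTransform

section Operator

lemma enorm_rpow_eq_lintegral {α E : Type*} [MeasurableSpace α] {μ : Measure α}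
    [NormedAddCommGroup E] {p : ℝ} (hp : 0 < p) (f : Lp E (ENNReal.ofReal p) μ) :
    ‖f‖ₑ ^ p = ∫⁻ x, ‖f x‖ₑ ^ p ∂μ := by
  rw [Lp.enorm_def, eLpNorm_eq_lintegral_rpow_enorm_toReal (by simpa using hp) (by simp),
    ENNReal.toReal_ofReal hp.le, ← ENNReal.rpow_mul, one_div_mul_cancel hp.ne', ENNReal.rpow_one]

variable {V : Type*} [NormedAddCommGroup V] [InnerProductSpace ℝ V] [FiniteDimensional ℝ V]
  [MeasurableSpace V] [BorelSpace V] {p p' : ℝ}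

lemma HasFourierTransform.lorentzENorm_le [Fact (1 ≤ ENNReal.ofReal p)]
    (hpp' : p.HolderConjugate p') (hp2 : p < 2) {f : Lp ℂ (ENNReal.ofReal p) (volume : Measure V)}
    {g : V → ℂ} (h : HasFourierTransform f g) :
    lorentzENorm volume p' p g ≤ paleyConst p ^ (1 / p) * ‖f‖ₑ := by
  have hp0 := hpp'.pos
  have hf : Measurable f := (Lp.stronglyMeasurable f).measurable
  have hnorm : ‖f‖ₑ ^ p = ∫⁻ x, ‖f x‖ₑ ^ p := enorm_rpow_eq_lintegral hp0 f
  have hI : ∫⁻ x, ‖f x‖ₑ ^ p < ∞ := hnorm ▸ by finiteness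
  have hcontrolled := h.rearrangementControlled hf hpp'.lt.le hp2.le hI
  rw [← ENNReal.rpow_le_rpow_iff hp0, ENNReal.mul_rpow_of_nonneg _ _ hp0.le, ← ENNReal.rpow_mul,
    one_div_mul_cancel hp0.ne', ENNReal.rpow_one, hnorm]
  exact hcontrolled.lorentzENorm_rpow_le hf.enorm hpp' hp2 hI

lemma quasiMeasurePreserving_const_smul {c : ℝ} (hc : c ≠ 0) :
    Measure.QuasiMeasurePreserving (fun x : V => c • x) := by
  refine ⟨measurable_const_smul c, ?_⟩
  rw [Measure.map_addHaar_smul _ hc]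
  exact Measure.smul_absolutelyContinuous

variable {d : ℕ}

lemma fourierIntegralFun_eq_fourier (f : EuclideanSpace ℝ (Fin d) → ℂ) :
    fourierIntegralFun f = fun x => 𝓕 f ((2 * Real.pi)⁻¹ • x) := by
  funext x
  rw [fourierIntegralFun, Real.fourier_eq']
  refine integral_congr_ae (ae_of_all _ fun t => ?_)
  have hphase : -2 * Real.pi * inner ℝ t ((2 * Real.pi)⁻¹ • x) = -inner ℝ x t := by
    rw [inner_smul_right, real_inner_comm t x]
    field_simp
  simp only [hphase, smul_eq_mul, mul_comm (f t)]
  push_cast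
  ring_nf

variable [Fact (1 ≤ ENNReal.ofReal p)]

lemma exists_isFourierTransform (hpp' : p.HolderConjugate p') (hp2 : p < 2) :
    ∃ T : Lp ℂ (ENNReal.ofReal p) (volume : Measure (EuclideanSpace ℝ (Fin d))) →ₗ[ℂ]
        lorentzSpace (volume : Measure (EuclideanSpace ℝ (Fin d))) hpp'.symm.pos hpp'.pos,
      IsFourierTransform T := by
  have hp0 := hpp'.pos
  have hexists (f : Lp ℂ (ENNReal.ofReal p) (volume : Measure (EuclideanSpace ℝ (Fin d)))) :
      ∃ g, HasFourierTransform f g := by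
    refine exists_hasFourierTransform (Lp.stronglyMeasurable f).measurable hpp'.lt.le hp2.le ?_
    rw [← enorm_rpow_eq_lintegral hp0]
    finiteness
  choose G hG using hexists
  have hc : 0 < (2 * Real.pi)⁻¹ := by positivity
  have hqmp : Measure.QuasiMeasurePreserving
      fun x : EuclideanSpace ℝ (Fin d) => (2 * Real.pi)⁻¹ • x :=
    quasiMeasurePreserving_const_smul hc.ne'
  have hadd (f g) : G (f + g) =ᵐ[volume] G f + G g :=
    (hG _).unique (((hG f).add (hG g)).congr_left (Lp.coeFn_add f g).symm)
  have hsmul (c : ℂ) (f) : G (c • f) =ᵐ[volume] c • G f :=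
    (hG _).unique (((hG f).const_smul c).congr_left (Lp.coeFn_smul c f).symm)
  have hbound (f) :=
    calc lorentzENorm volume p' p (fun x => G f ((2 * Real.pi)⁻¹ • x))
        = ENNReal.ofReal (((2 * Real.pi)⁻¹ ^ finrank ℝ (EuclideanSpace ℝ (Fin d))) ^ (-(1 / p')))
            * lorentzENorm volume p' p (G f) := lorentzENorm_comp_smul _ hp0 _ hc
      _ ≤ ENNReal.ofReal (((2 * Real.pi)⁻¹ ^ finrank ℝ (EuclideanSpace ℝ (Fin d))) ^ (-(1 / p')))
            * (paleyConst p ^ (1 / p) * ‖f‖ₑ) := by gcongr; exact (hG f).lorentzENorm_le hpp' hp2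
      _ = (ENNReal.ofReal
            (((2 * Real.pi)⁻¹ ^ finrank ℝ (EuclideanSpace ℝ (Fin d))) ^ (-(1 / p')))
              * paleyConst p ^ (1 / p)).toNNReal * ‖f‖ₑ := by
          have := ENNReal.rpow_ne_top_of_nonneg (one_div_pos.mpr hp0).le
            (paleyConst_lt_top hpp'.lt hp2).ne
          rw [ENNReal.coe_toNNReal (by finiteness), mul_assoc]
  obtain ⟨T, hT, hTG⟩ := exists_linearMap_lorentzSpace hpp'.symm.pos hp0
    (fun f => (hG f).locallyIntegrable.aestronglyMeasurable.comp_quasiMeasurePreserving hqmp)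
    (fun f g => hqmp.ae_eq_comp (hadd f g)) (fun c f => hqmp.ae_eq_comp (hsmul c f)) hbound
  refine ⟨T, hT, fun f hf => (hTG f).trans ?_⟩
  rw [fourierIntegralFun_eq_fourier]
  exact hqmp.ae_eq_comp ((hG f).unique (.of_integrable hf))

end Operator

section AlmostDisjoint

variable {α ι E : Type*} [MeasurableSpace α] {μ : Measure α} [NormedAddCommGroup E] {p : ℝ}

lemma eLpNorm_sum_rpow_of_disjoint_support (hp : 0 < p) {g : ι → α → E}
    (hg : ∀ k, AEStronglyMeasurable (g k) μ)
    (hdisj : Pairwise (Function.onFun Disjoint fun k => Function.support (g k))) (s : Finset ι) :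
    eLpNorm (∑ k ∈ s, g k) (ENNReal.ofReal p) μ ^ p
      = ∑ k ∈ s, eLpNorm (g k) (ENNReal.ofReal p) μ ^ p := by
  have hpointwise (x : α) : ‖(∑ k ∈ s, g k) x‖ₑ ^ p = ∑ k ∈ s, ‖g k x‖ₑ ^ p := by
    rw [Finset.sum_apply]
    by_cases h : ∃ k ∈ s, g k x ≠ 0
    · obtain ⟨k, hk, hkx⟩ := h
      have hother (j : ι) (hjk : j ≠ k) : g j x = 0 :=
        Function.notMem_support.mp fun hjx => disjoint_left.mp (hdisj hjk) hjx hkx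
      rw [Finset.sum_eq_single_of_mem k hk fun j _ hjk => hother j hjk,
        Finset.sum_eq_single_of_mem k hk fun j _ hjk => by
          rw [hother j hjk, enorm_zero, ENNReal.zero_rpow_of_pos hp]]
    · push Not at h
      rw [Finset.sum_eq_zero h, Finset.sum_eq_zero fun k hk => by
        rw [h k hk, enorm_zero, ENNReal.zero_rpow_of_pos hp]]
      simp [hp]
  simp only [eLpNorm_eq_lintegral_rpow_enorm_toReal (ENNReal.ofReal_pos.mpr hp).ne'
    ENNReal.ofReal_ne_top, ENNReal.toReal_ofReal hp.le, one_div, ENNReal.rpow_inv_rpow hp.ne',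
    hpointwise]
  exact lintegral_finsetSum' s fun k _ => (hg k).enorm.pow_const p

variable {𝕜 : Type*} [NormedField 𝕜] [NormedSpace 𝕜 E]

lemma eLpNorm_sum_smul_le_of_disjoint_support (hp : 0 < p) {g : ι → α → E}
    (hg : ∀ k, AEStronglyMeasurable (g k) μ)
    (hdisj : Pairwise (Function.onFun Disjoint fun k => Function.support (g k))) {B : ℝ≥0∞}
    (hB : ∀ k, eLpNorm (g k) (ENNReal.ofReal p) μ ≤ B) (s : Finset ι) (a : ι → 𝕜) :
    eLpNorm (∑ k ∈ s, a k • g k) (ENNReal.ofReal p) μ ≤ B * (∑ k ∈ s, ‖a k‖ₑ ^ p) ^ (1 / p) := by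
  rw [one_div, ← ENNReal.rpow_le_rpow_iff hp, ENNReal.mul_rpow_of_nonneg _ _ hp.le,
    ENNReal.rpow_inv_rpow hp.ne', eLpNorm_sum_rpow_of_disjoint_support hp
      (fun k => (hg k).const_smul _) fun j k hjk => (hdisj hjk).mono
        (Function.support_const_smul_subset _ _) (Function.support_const_smul_subset _ _),
    Finset.mul_sum]
  gcongr with k
  rw [eLpNorm_const_smul, ENNReal.mul_rpow_of_nonneg _ _ hp.le, mul_comm]
  gcongr
  exact hB k

lemma eLpNorm_sum_smul_le_tsum (hp : 1 ≤ p) {g : ι → α → E}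
    (hg : ∀ k, AEStronglyMeasurable (g k) μ) (s : Finset ι) (a : ι → 𝕜) :
    eLpNorm (∑ k ∈ s, a k • g k) (ENNReal.ofReal p) μ
      ≤ (∑' k, eLpNorm (g k) (ENNReal.ofReal p) μ) * (∑ k ∈ s, ‖a k‖ₑ ^ p) ^ (1 / p) := by
  have hcoeff (k : ι) (hk : k ∈ s) : ‖a k‖ₑ ≤ (∑ k ∈ s, ‖a k‖ₑ ^ p) ^ (1 / p) := by
    rw [one_div, ENNReal.le_rpow_inv_iff (one_pos.trans_le hp)]
    exact Finset.single_le_sum (f := fun k => ‖a k‖ₑ ^ p) (fun _ _ => zero_le) hk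
  calc eLpNorm (∑ k ∈ s, a k • g k) (ENNReal.ofReal p) μ
      ≤ ∑ k ∈ s, eLpNorm (a k • g k) (ENNReal.ofReal p) μ :=
        eLpNorm_sum_le (fun k _ => (hg k).const_smul _) (by simpa)
    _ ≤ ∑ k ∈ s, eLpNorm (g k) (ENNReal.ofReal p) μ * (∑ k ∈ s, ‖a k‖ₑ ^ p) ^ (1 / p) := by
        refine Finset.sum_le_sum fun k hk => ?_
        rw [eLpNorm_const_smul, mul_comm]
        gcongr
        exact hcoeff k hk
    _ ≤ _ := by
        rw [← Finset.sum_mul]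
        gcongr
        exact ENNReal.sum_le_tsum s

lemma eLpNorm_sum_smul_le_of_disjoint (hp : 1 ≤ p) {f : ι → α → E}
    (hf : ∀ k, AEStronglyMeasurable (f k) μ) {A : ι → Set α} (hA : ∀ k, MeasurableSet (A k))
    (hdisj : Pairwise (Function.onFun Disjoint A)) {B : ℝ≥0∞}
    (hB : ∀ k, eLpNorm (f k) (ENNReal.ofReal p) μ ≤ B) (s : Finset ι) (a : ι → 𝕜) :
    eLpNorm (∑ k ∈ s, a k • f k) (ENNReal.ofReal p) μ
      ≤ (B + ∑' k, eLpNorm ((A k)ᶜ.indicator (f k)) (ENNReal.ofReal p) μ)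
        * (∑ k ∈ s, ‖a k‖ₑ ^ p) ^ (1 / p) := by
  have hmeas (k : ι) : AEStronglyMeasurable ((A k).indicator (f k)) μ := (hf k).indicator (hA k)
  have hmeas' (k : ι) : AEStronglyMeasurable ((A k)ᶜ.indicator (f k)) μ :=
    (hf k).indicator (hA k).compl
  have hsplit : ∑ k ∈ s, a k • f k
      = ∑ k ∈ s, a k • (A k).indicator (f k) + ∑ k ∈ s, a k • (A k)ᶜ.indicator (f k) := by
    simp only [← Finset.sum_add_distrib, ← smul_add, indicator_self_add_compl]
  rw [hsplit, add_mul]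
  refine (eLpNorm_add_le (Finset.aestronglyMeasurable_sum _ fun k _ => (hmeas k).const_smul _)
    (Finset.aestronglyMeasurable_sum _ fun k _ => (hmeas' k).const_smul _) (by simpa)).trans
    (add_le_add ?_ (eLpNorm_sum_smul_le_tsum hp hmeas' s a))
  exact eLpNorm_sum_smul_le_of_disjoint_support (one_pos.trans_le hp) hmeas
    (fun j k hjk => (hdisj hjk).mono support_indicator_subset support_indicator_subset)
    (fun k => (eLpNorm_indicator_le _).trans (hB k)) s a

end AlmostDisjoint

section Dilates

variable {V E : Type*} [NormedAddCommGroup V] [NormedSpace ℝ V] [NormedAddCommGroup E]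
  [NormedSpace ℝ E] {p c : ℝ}

/-- The dilate `c^{-n/p} f(c⁻¹ ·)` of a function `f` on an `n`-dimensional space, normalized so as
to have the same `L^p` norm as `f`. -/
def lpDilate (p c : ℝ) (f : V → E) (x : V) : E :=
  (c ^ finrank ℝ V) ^ (-(1 / p)) • f (c⁻¹ • x)

lemma indicator_preimage_inv_smul_lpDilate (f : V → E) (A : Set V) :
    ((c⁻¹ • ·) ⁻¹' A).indicator (lpDilate p c f) = lpDilate p c (A.indicator f) := by
  classical
  funext x
  simp [lpDilate, indicator_apply]

variable [FiniteDimensional ℝ V] [MeasurableSpace V] [BorelSpace V]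

lemma eLpNorm_lpDilate (μ : Measure V) [μ.IsAddHaarMeasure] (hp : 0 < p) (hc : 0 < c)
    (f : V → E) :
    eLpNorm (lpDilate p c f) (ENNReal.ofReal p) μ = eLpNorm f (ENNReal.ofReal p) μ := by
  have hcn : 0 < c ^ finrank ℝ V := by positivity
  have hcomp : eLpNorm (fun x => f (c⁻¹ • x)) (ENNReal.ofReal p) μ
      = ENNReal.ofReal ((c ^ finrank ℝ V) ^ (1 / p)) * eLpNorm f (ENNReal.ofReal p) μ := by
    have hemb := (Homeomorph.smulOfNeZero c⁻¹ (inv_pos.mpr hc).ne' (α := V)).measurableEmbedding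
    have hmap : μ.map (c⁻¹ • ·) = ENNReal.ofReal (c ^ finrank ℝ V) • μ := by
      rw [Measure.map_addHaar_smul _ (inv_pos.mpr hc).ne', inv_pow, inv_inv, abs_of_pos hcn]
    calc eLpNorm (fun x => f (c⁻¹ • x)) (ENNReal.ofReal p) μ
        = eLpNorm f (ENNReal.ofReal p) (μ.map (c⁻¹ • ·)) := hemb.eLpNorm_map_measure.symm
      _ = _ := by
        rw [hmap, eLpNorm_smul_measure_of_ne_top ENNReal.ofReal_ne_top,
          ENNReal.toReal_div, ENNReal.toReal_one, ENNReal.toReal_ofReal hp.le,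
          ENNReal.ofReal_rpow_of_pos hcn, smul_eq_mul]
  change eLpNorm ((c ^ finrank ℝ V) ^ (-(1 / p)) • fun x => f (c⁻¹ • x)) _ _ = _
  rw [eLpNorm_const_smul, hcomp, ← mul_assoc, Real.enorm_of_nonneg (by positivity),
    ← ENNReal.ofReal_mul (by positivity), ← Real.rpow_add hcn, neg_add_cancel, Real.rpow_zero,
    ENNReal.ofReal_one, one_mul]

end Dilates

section FourierDilates

variable {V : Type*} [NormedAddCommGroup V] [InnerProductSpace ℝ V] [FiniteDimensional ℝ V]
  [MeasurableSpace V] [BorelSpace V] {p p' c : ℝ}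

lemma fourier_lpDilate (hpp' : p.HolderConjugate p') (hc : 0 < c) (f : V → ℂ) (y : V) :
    𝓕 (lpDilate p c f) y = ((c ^ finrank ℝ V) ^ (1 / p')) • 𝓕 f (c • y) := by
  have hcn : 0 < c ^ finrank ℝ V := by positivity
  have hexp : (c ^ finrank ℝ V) ^ (-(1 / p)) * c ^ finrank ℝ V = (c ^ finrank ℝ V) ^ (1 / p') := by
    rw [← Real.rpow_add_one hcn.ne', one_div, one_div, ← hpp'.one_sub_inv, neg_add_eq_sub]
  have hphase (x : V) : Real.fourierChar (-inner ℝ x y) • lpDilate p c f x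
      = (c ^ finrank ℝ V) ^ (-(1 / p)) •
        (Real.fourierChar (-inner ℝ (c⁻¹ • x) (c • y)) • f (c⁻¹ • x)) := by
    have hinner : inner ℝ (c⁻¹ • x) (c • y) = inner ℝ x y := by
      rw [real_inner_smul_left, real_inner_smul_right, inv_mul_cancel_left₀ hc.ne']
    rw [hinner]
    exact smul_comm _ _ _
  simp only [Real.fourier_eq, hphase]
  rw [integral_smul, Measure.integral_comp_inv_smul volume
    (fun z => Real.fourierChar (-inner ℝ z (c • y)) • f z), abs_of_pos hcn, smul_smul, hexp]

end FourierDilates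

section Shell

variable {V : Type*} [NormedAddCommGroup V]

/-- The annulus `R⁻¹ < ‖x‖ ≤ R`, outside of which a Schwartz function is small in `L^p` when `R` is
large. -/
def shell (V : Type*) [NormedAddCommGroup V] (R : ℝ) : Set V := {x | ‖x‖ ∈ Ioc R⁻¹ R}

lemma measurableSet_shell [MeasurableSpace V] [OpensMeasurableSpace V] (R : ℝ) :
    MeasurableSet (shell V R) :=
  measurable_norm measurableSet_Ioc

lemma pairwise_disjoint_preimage_shell [NormedSpace ℝ V] :
    Pairwise (Function.onFun Disjoint
      fun k : ℕ => (((2 : ℝ) ^ k ^ 2)⁻¹ • ·) ⁻¹' shell V (2 ^ k)) := by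
  have hmono : Monotone fun k : ℕ => (2 : ℝ) ^ (k * (k - 1)) := fun j k hjk => by
    dsimp only
    gcongr
    exact one_le_two
  refine hmono.pairwise_disjoint_on_Ioc_succ.mono fun j k hjk => ?_
  have hsub (k : ℕ) : (((2 : ℝ) ^ k ^ 2)⁻¹ • ·) ⁻¹' shell V (2 ^ k)
      ⊆ norm ⁻¹' Ioc ((2 : ℝ) ^ (k * (k - 1))) (2 ^ ((k + 1) * k)) := by
    rintro x ⟨hlo, hhi⟩
    rw [norm_smul, norm_inv, norm_pow, Real.norm_two, inv_mul_eq_div] at hlo hhi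
    rw [lt_div_iff₀ (by positivity)] at hlo
    rw [div_le_iff₀ (by positivity)] at hhi
    refine ⟨lt_of_le_of_lt (le_of_eq ?_) hlo, hhi.trans_eq ?_⟩
    · rcases k with _ | k
      · simp
      · rw [eq_inv_mul_iff_mul_eq₀ (by positivity), ← pow_add]
        congr 1
        simp only [add_tsub_cancel_right]
        ring
    · rw [← pow_add]
      congr 1
      ring
  exact (Disjoint.preimage norm hjk).mono (hsub j) (hsub k)

end Shell

section SchwartzDilates

variable {V E : Type*} [NormedAddCommGroup V] [InnerProductSpace ℝ V] [FiniteDimensional ℝ V]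
  [MeasurableSpace V] [BorelSpace V] [NormedAddCommGroup E] [NormedSpace ℝ E] {p : ℝ}

lemma exists_eLpNorm_indicator_closedBall_le [Nontrivial V] (hp : 0 < p) (f : 𝓢(V, E)) :
    ∃ C : ℝ≥0, ∀ R : ℝ, 1 ≤ R →
      eLpNorm ((Metric.closedBall 0 R⁻¹).indicator f) (ENNReal.ofReal p) volume
        ≤ C * ENNReal.ofReal (R ^ (-(1 / p))) := by
  set S := SchwartzMap.seminorm ℝ 0 0 f
  set v := volume (Metric.ball (0 : V) 1)
  have hv : v ≠ ∞ := measure_ball_lt_top.ne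
  refine ⟨(ENNReal.ofReal S * v ^ (1 / p)).toNNReal, fun R hR => ?_⟩
  have hR0 : 0 < R := one_pos.trans_le hR
  have hfinrank : R⁻¹ ^ finrank ℝ V ≤ R⁻¹ :=
    pow_le_of_le_one (by positivity) (inv_le_one_of_one_le₀ hR) finrank_pos.ne'
  calc eLpNorm ((Metric.closedBall 0 R⁻¹).indicator f) (ENNReal.ofReal p) volume
      ≤ eLpNorm ((Metric.closedBall 0 R⁻¹).indicator fun _ : V => S) (ENNReal.ofReal p)
          volume := by
        refine eLpNorm_mono fun x => ?_
        by_cases hx : x ∈ Metric.closedBall (0 : V) R⁻¹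
        · rw [indicator_of_mem hx, indicator_of_mem hx]
          exact (f.norm_le_seminorm ℝ x).trans (le_abs_self _)
        · rw [indicator_of_notMem hx, indicator_of_notMem hx, norm_zero, norm_zero]
    _ ≤ ‖S‖ₑ * volume (Metric.closedBall (0 : V) R⁻¹) ^ (1 / (ENNReal.ofReal p).toReal) :=
        eLpNorm_indicator_const_le _ _
    _ ≤ ENNReal.ofReal S * (ENNReal.ofReal R⁻¹ * v) ^ (1 / p) := by
        rw [Real.enorm_of_nonneg (apply_nonneg _ _), ENNReal.toReal_ofReal hp.le,
          Measure.addHaar_closedBall _ _ (by positivity)]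
        gcongr
    _ = (ENNReal.ofReal S * v ^ (1 / p)).toNNReal * ENNReal.ofReal (R ^ (-(1 / p))) := by
        rw [ENNReal.coe_toNNReal (by finiteness), ENNReal.mul_rpow_of_nonneg _ _ (by positivity),
          ENNReal.ofReal_rpow_of_pos (by positivity), Real.inv_rpow hR0.le, ← Real.rpow_neg hR0.le]
        ring

lemma exists_eLpNorm_indicator_lt_norm_le (hp : 1 ≤ p) (f : 𝓢(V, E)) :
    ∃ C : ℝ≥0, ∀ R : ℝ, 1 ≤ R →
      eLpNorm ({x | R < ‖x‖}.indicator f) (ENNReal.ofReal p) volume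
        ≤ C * ENNReal.ofReal (R ^ (-(1 / p))) := by
  have hgrowth : Function.HasTemperateGrowth fun x : V => ‖x‖ ^ 2 := by fun_prop
  set ψ : 𝓢(V, E) := SchwartzMap.smulLeftCLM E (fun x : V => ‖x‖ ^ 2) f
  have hψ : eLpNorm ψ (ENNReal.ofReal p) volume ≠ ∞ := (ψ.memLp _ volume).2.ne
  refine ⟨(eLpNorm ψ (ENNReal.ofReal p) volume).toNNReal, fun R hR => ?_⟩
  have hR0 : 0 < R := one_pos.trans_le hR
  have hpointwise (x : V) : ‖{x | R < ‖x‖}.indicator f x‖ ≤ ‖(R⁻¹ • ⇑ψ) x‖ := by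
    by_cases hx : R < ‖x‖
    · have hRx : R ≤ ‖x‖ ^ 2 := hx.le.trans (le_self_pow₀ (hR.trans hx.le) two_ne_zero)
      rw [indicator_of_mem (show x ∈ {x | R < ‖x‖} from hx), Pi.smul_apply,
        SchwartzMap.smulLeftCLM_apply_apply hgrowth, norm_smul, norm_smul, norm_inv, norm_pow,
        norm_norm, Real.norm_of_nonneg hR0.le, inv_mul_eq_div, le_div_iff₀ hR0, mul_comm]
      gcongr
    · rw [indicator_of_notMem (show x ∉ {x | R < ‖x‖} from hx), norm_zero]
      positivity
  calc eLpNorm ({x | R < ‖x‖}.indicator f) (ENNReal.ofReal p) volume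
      ≤ eLpNorm (R⁻¹ • ⇑ψ) (ENNReal.ofReal p) volume := eLpNorm_mono hpointwise
    _ = eLpNorm ψ (ENNReal.ofReal p) volume * ENNReal.ofReal R⁻¹ := by
        rw [eLpNorm_const_smul, Real.enorm_of_nonneg (by positivity), mul_comm]
    _ ≤ (eLpNorm ψ (ENNReal.ofReal p) volume).toNNReal * ENNReal.ofReal (R ^ (-(1 / p))) := by
        rw [ENNReal.coe_toNNReal hψ, ← Real.rpow_neg_one]
        gcongr
        exact (div_le_one (by positivity)).mpr hp

lemma exists_eLpNorm_indicator_compl_shell_le [Nontrivial V] (hp : 1 ≤ p) (f : 𝓢(V, E)) :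
    ∃ C : ℝ≥0, ∀ R : ℝ, 1 ≤ R →
      eLpNorm ((shell V R)ᶜ.indicator f) (ENNReal.ofReal p) volume
        ≤ C * ENNReal.ofReal (R ^ (-(1 / p))) := by
  obtain ⟨C₁, hC₁⟩ := exists_eLpNorm_indicator_closedBall_le (one_pos.trans_le hp) f
  obtain ⟨C₂, hC₂⟩ := exists_eLpNorm_indicator_lt_norm_le hp f
  refine ⟨C₁ + C₂, fun R hR => ?_⟩
  have hcompl : (shell V R)ᶜ = Metric.closedBall 0 R⁻¹ ∪ {x | R < ‖x‖} := by
    ext x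
    simp only [shell, mem_compl_iff, mem_ofPred_eq, mem_Ioc, not_and_or, not_lt, not_le,
      mem_union, mem_closedBall_zero_iff]
  have hdisj : Disjoint (Metric.closedBall 0 R⁻¹) {x : V | R < ‖x‖} := by
    refine disjoint_left.mpr fun x hx hRx => ?_
    exact (mem_closedBall_zero_iff.mp hx).not_gt
      (((inv_le_one_of_one_le₀ hR).trans hR).trans_lt hRx)
  have hf : AEStronglyMeasurable f volume := f.continuous.aestronglyMeasurable
  rw [hcompl, indicator_union_of_disjoint hdisj, ENNReal.coe_add, add_mul]
  refine (eLpNorm_add_le (hf.indicator measurableSet_closedBall)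
    (hf.indicator (measurableSet_lt measurable_const measurable_norm)) (by simpa)).trans ?_
  exact add_le_add (hC₁ R hR) (hC₂ R hR)

lemma exists_eLpNorm_sum_smul_lpDilate_le {𝕜 : Type*} [NormedField 𝕜] [NormedSpace 𝕜 E]
    [Nontrivial V] (hp : 1 ≤ p) (f : 𝓢(V, E)) :
    ∃ M : ℝ≥0, ∀ (s : Finset ℕ) (a : ℕ → 𝕜),
      eLpNorm (∑ k ∈ s, a k • lpDilate p (2 ^ k ^ 2) f) (ENNReal.ofReal p) volume
        ≤ M * (∑ k ∈ s, ‖a k‖ₑ ^ p) ^ (1 / p) := by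
  have hp0 : 0 < p := one_pos.trans_le hp
  obtain ⟨C, hC⟩ := exists_eLpNorm_indicator_compl_shell_le hp f
  set q := ENNReal.ofReal (2 ^ (-(1 / p)))
  have hq : q < 1 := by
    rw [ENNReal.ofReal_lt_one]
    exact Real.rpow_lt_one_of_one_lt_of_neg one_lt_two (by simpa)
  have htail (k : ℕ) : eLpNorm (((((2 : ℝ) ^ k ^ 2)⁻¹ • ·) ⁻¹' shell V (2 ^ k))ᶜ.indicator
      (lpDilate p (2 ^ k ^ 2) f)) (ENNReal.ofReal p) volume ≤ C * q ^ k := by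
    rw [← preimage_compl, indicator_preimage_inv_smul_lpDilate,
      eLpNorm_lpDilate _ hp0 (by positivity), ← ENNReal.ofReal_pow (by positivity),
      Real.rpow_pow_comm zero_le_two]
    exact hC _ (one_le_pow₀ one_le_two)
  have hB : eLpNorm f (ENNReal.ofReal p) volume ≠ ∞ := (f.memLp _ volume).2.ne
  have hsum : ∑' k, C * q ^ k ≠ ∞ := by
    rw [ENNReal.tsum_mul_left, ENNReal.tsum_geometric]
    have : (1 - q)⁻¹ ≠ ∞ := ENNReal.inv_ne_top.mpr (tsub_pos_of_lt hq).ne'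
    finiteness
  refine ⟨(eLpNorm f (ENNReal.ofReal p) volume + ∑' k, C * q ^ k).toNNReal, fun s a => ?_⟩
  have hmeas (k : ℕ) : AEStronglyMeasurable (lpDilate p (2 ^ k ^ 2) f) volume :=
    (f.continuous.comp (continuous_const_smul _)).aestronglyMeasurable.const_smul _
  refine (eLpNorm_sum_smul_le_of_disjoint hp hmeas
    (fun k => measurable_const_smul _ (measurableSet_shell _)) pairwise_disjoint_preimage_shell
    (fun k => (eLpNorm_lpDilate _ hp0 (by positivity) _).le) s a).trans ?_
  rw [ENNReal.coe_toNNReal (by finiteness)]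
  gcongr with k
  exact htail k

end SchwartzDilates

section FourierAnnulus

variable {V : Type*} [NormedAddCommGroup V] [InnerProductSpace ℝ V] [FiniteDimensional ℝ V]
  [MeasurableSpace V] [BorelSpace V] {p p' : ℝ}

lemma conj_fourierInv (φ : V → ℂ) (w : V) :
    starRingEnd ℂ (𝓕⁻ φ w) = 𝓕⁻ (fun v => starRingEnd ℂ (φ (-v))) w := by
  rw [Real.fourierInv_eq', Real.fourierInv_eq', ← integral_conj, ← integral_neg_eq_self]
  refine integral_congr_ae (ae_of_all _ fun v => ?_)
  simp only [smul_eq_mul, map_mul, inner_neg_left, ← Complex.exp_conj, Complex.conj_I,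
    Complex.conj_ofReal]
  push_cast
  ring_nf

lemma exists_schwartzMap_fourier_annulus :
    ∃ ρ : 𝓢(V, ℝ), (∀ y, ‖y‖ ∈ Icc (5 / 4) (3 / 2) → 𝓕 (fun x => (ρ x : ℂ)) y = 1) ∧
      ∀ y, ‖y‖ ∉ Ioo 1 2 → 𝓕 (fun x => (ρ x : ℂ)) y = 0 := by
  let b₁ : ContDiffBump (0 : V) := ⟨3 / 2, 2, by norm_num, by norm_num⟩
  let b₂ : ContDiffBump (0 : V) := ⟨1, 5 / 4, by norm_num, by norm_num⟩
  have hsmooth : ContDiff ℝ (⊤ : ℕ∞) fun x : V => ((b₁ x - b₂ x : ℝ) : ℂ) :=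
    Complex.ofRealCLM.contDiff.comp (b₁.contDiff.sub b₂.contDiff)
  have hcompact : HasCompactSupport fun x : V => ((b₁ x - b₂ x : ℝ) : ℂ) :=
    (b₁.hasCompactSupport.sub b₂.hasCompactSupport).comp_left (g := ((↑) : ℝ → ℂ)) rfl
  set φ : 𝓢(V, ℂ) := hcompact.toSchwartzMap hsmooth
  have hφ (y : V) : φ y = ((b₁ y - b₂ y : ℝ) : ℂ) := rfl
  have hreal (x : V) : (((𝓕⁻ φ) x).re : ℂ) = (𝓕⁻ φ) x := by
    rw [← Complex.conj_eq_iff_re, SchwartzMap.fourierInv_coe, conj_fourierInv]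
    simp only [hφ, Complex.conj_ofReal, b₁.neg, b₂.neg]
    rfl
  have hfourier : 𝓕 (fun x => (SchwartzMap.postcompCLM Complex.reCLM (𝓕⁻ φ) x : ℂ)) = φ := by
    simp only [SchwartzMap.postcompCLM_apply, Complex.reCLM_apply, hreal]
    rw [← SchwartzMap.fourier_coe, FourierTransform.fourier_fourierInv_eq]
  refine ⟨SchwartzMap.postcompCLM Complex.reCLM (𝓕⁻ φ), fun y hy => ?_, fun y hy => ?_⟩
  all_goals rw [hfourier, hφ]
  · rw [b₁.one_of_mem_closedBall (by simpa using hy.2), b₂.zero_of_le_dist (by simpa using hy.1)]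
    simp
  · rcases le_or_gt ‖y‖ 1 with hy1 | hy1
    · rw [b₁.one_of_mem_closedBall (by simp [b₁]; linarith),
        b₂.one_of_mem_closedBall (by simpa using hy1)]
      simp
    · have hy2 : 2 ≤ ‖y‖ := not_lt.mp fun h => hy ⟨hy1, h⟩
      rw [b₁.zero_of_le_dist (by simpa using hy2), b₂.zero_of_le_dist (by simp [b₂]; linarith)]
      simp

lemma two_pow_sq_mul_notMem_Ioo {r : ℝ} {j k : ℕ} (hjk : j ≠ k)
    (hk : 2 ^ k ^ 2 * r ∈ Icc (5 / 4 : ℝ) (3 / 2)) : 2 ^ j ^ 2 * r ∉ Ioo (1 : ℝ) 2 := by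
  have hdouble {i l : ℕ} (h : i < l) : 2 * (2 : ℝ) ^ i ^ 2 ≤ 2 ^ l ^ 2 := by
    rw [← pow_succ']
    exact pow_le_pow_right₀ one_le_two (by nlinarith)
  have hr : 0 < r :=
    pos_of_mul_pos_right (lt_of_lt_of_le (by norm_num) hk.1) (by positivity : (0 : ℝ) ≤ 2 ^ k ^ 2)
  rintro ⟨h1, h2⟩
  rcases hjk.lt_or_gt with h | h
  · nlinarith [hdouble h, hk.2]
  · nlinarith [hdouble h, hk.1]

lemma fourier_sum_smul {ι : Type*} (s : Finset ι) (a : ι → ℂ) {f : ι → V → ℂ}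
    (hf : ∀ k, Integrable (f k)) : 𝓕 (∑ k ∈ s, a k • f k) = ∑ k ∈ s, a k • 𝓕 (f k) := by
  funext y
  have hint (k : ι) : Integrable fun v => a k • 𝐞 (-inner ℝ v y) • f k v :=
    ((Real.fourierIntegral_convergent_iff y).mpr (hf k)).smul (a k)
  simp only [Real.fourier_eq, Finset.sum_apply, Pi.smul_apply, Finset.smul_sum,
    smul_comm _ (a _)]
  rw [integral_finsetSum s fun k _ => hint k]
  simp only [integral_smul]

section Dilate

variable {E : Type*} [NormedAddCommGroup E] [NormedSpace ℝ E] {c : ℝ} {f : V → E}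

lemma integrable_lpDilate (hc : 0 < c) (hf : Integrable f) : Integrable (lpDilate p c f) :=
  (hf.comp_smul (inv_pos.mpr hc).ne').smul _

lemma memLp_lpDilate (hp : 0 < p) (hc : 0 < c) (hf : MemLp f (ENNReal.ofReal p)) :
    MemLp (lpDilate p c f) (ENNReal.ofReal p) := by
  refine ⟨(hf.1.comp_quasiMeasurePreserving
    (quasiMeasurePreserving_const_smul (inv_pos.mpr hc).ne')).const_smul _, ?_⟩
  exact (eLpNorm_lpDilate volume hp hc f).trans_lt hf.2

end Dilate

lemma enorm_fourier_sum_smul_lpDilate (hpp' : p.HolderConjugate p') {f : V → ℂ} (hf : Integrable f)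
    (hf1 : ∀ y, ‖y‖ ∈ Icc (5 / 4) (3 / 2) → 𝓕 f y = 1) (hf0 : ∀ y, ‖y‖ ∉ Ioo 1 2 → 𝓕 f y = 0)
    {s : Finset ℕ} (a : ℕ → ℂ) {k : ℕ} (hk : k ∈ s) {y : V}
    (hy : ‖(2 : ℝ) ^ k ^ 2 • y‖ ∈ Icc (5 / 4) (3 / 2)) :
    ‖𝓕 (∑ j ∈ s, a j • lpDilate p (2 ^ j ^ 2) f) y‖ₑ
      = ‖a k‖ₑ * ENNReal.ofReal ((((2 : ℝ) ^ k ^ 2) ^ finrank ℝ V) ^ (1 / p')) := by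
  have hoff (j : ℕ) (hjk : j ≠ k) : 𝓕 f ((2 : ℝ) ^ j ^ 2 • y) = 0 := by
    rw [norm_smul, norm_pow, Real.norm_two] at hy
    refine hf0 _ ?_
    rw [norm_smul, norm_pow, Real.norm_two]
    exact two_pow_sq_mul_notMem_Ioo hjk hy
  rw [fourier_sum_smul s a fun j => integrable_lpDilate (by positivity) hf, Finset.sum_apply,
    Finset.sum_eq_single_of_mem k hk fun j _ hjk => ?_]
  · rw [Pi.smul_apply, fourier_lpDilate hpp' (by positivity), hf1 _ hy, enorm_smul, enorm_smul,
      enorm_one, mul_one, Real.enorm_of_nonneg (by positivity)]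
  · rw [Pi.smul_apply, fourier_lpDilate hpp' (by positivity), hoff j hjk, smul_zero, smul_zero]

end FourierAnnulus

section LowerEstimate

lemma pairwise_disjoint_Ico_half_div {w : ℕ → ℝ} (hw : ∀ k, 0 < w k)
    (hw_succ : ∀ k, 2 * w k ≤ w (k + 1)) {v : ℝ} (hv : 0 ≤ v) :
    Pairwise (Function.onFun Disjoint fun k => Ico (v / w k / 2) (v / w k)) := by
  have hhalf (k : ℕ) : v / w (k + 1) ≤ v / w k / 2 := by
    rw [div_div, mul_comm (w k)]
    exact div_le_div_of_nonneg_left hv (mul_pos two_pos (hw k)) (hw_succ k)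
  have hanti : Antitone fun k => v / w k :=
    antitone_nat_of_succ_le fun k => (hhalf k).trans (half_le_self (div_nonneg hv (hw k).le))
  exact hanti.pairwise_disjoint_on_Ico_succ.mono fun i j hij =>
    hij.mono (Ico_subset_Ico_left (hhalf i)) (Ico_subset_Ico_left (hhalf j))

lemma two_mul_two_pow_sq_pow_le {n : ℕ} (hn : 0 < n) (k : ℕ) :
    2 * ((2 : ℝ) ^ k ^ 2) ^ n ≤ (2 ^ (k + 1) ^ 2) ^ n := by
  rw [← pow_mul, ← pow_mul, ← pow_succ']
  refine pow_le_pow_right₀ one_le_two ?_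
  calc k ^ 2 * n + 1 ≤ k ^ 2 * n + (2 * k + 1) * n := by gcongr; nlinarith
    _ = (k + 1) ^ 2 * n := by ring

variable {V : Type*} [NormedAddCommGroup V] [InnerProductSpace ℝ V] [FiniteDimensional ℝ V]
  [MeasurableSpace V] [BorelSpace V] {p p' : ℝ}

lemma volume_norm_mem_Icc_pos [Nontrivial V] {a b : ℝ} (ha : 0 ≤ a) (hab : a < b) :
    0 < volume {y : V | ‖y‖ ∈ Icc a b} := by
  obtain ⟨c, hac, hcb⟩ := exists_between hab
  obtain ⟨y, hy⟩ := exists_norm_eq V (ha.trans hac.le)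
  have hopen : IsOpen {y : V | ‖y‖ ∈ Ioo a b} := isOpen_Ioo.preimage continuous_norm
  refine (hopen.measure_pos volume ⟨y, ?_⟩).trans_le
    (measure_mono fun _ hz => Ioo_subset_Icc_self hz)
  simp [hy, hac, hcb]

lemma ofReal_div_le_volume_norm_smul_mem {c v : ℝ} (hc : 0 < c) {t : Set ℝ}
    (hvol : ENNReal.ofReal v ≤ volume {y : V | ‖y‖ ∈ t}) :
    ENNReal.ofReal (v / c ^ finrank ℝ V) ≤ volume {y : V | ‖c • y‖ ∈ t} := by
  have hpre := Measure.addHaar_preimage_smul (volume : Measure V) hc.ne' {y : V | ‖y‖ ∈ t}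
  have hinv : 0 < (c ^ finrank ℝ V)⁻¹ := by positivity
  rw [abs_of_pos hinv] at hpre
  rw [div_eq_inv_mul, ENNReal.ofReal_mul hinv.le]
  exact (mul_le_mul_right hvol _).trans_eq hpre.symm

lemma mul_sum_rpow_le_lorentzENorm_fourier_rpow [Nontrivial V] (hpp' : p.HolderConjugate p')
    {f : V → ℂ} (hf : Integrable f) (hf1 : ∀ y, ‖y‖ ∈ Icc (5 / 4) (3 / 2) → 𝓕 f y = 1)
    (hf0 : ∀ y, ‖y‖ ∉ Ioo 1 2 → 𝓕 f y = 0) {v : ℝ} (hv : 0 < v)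
    (hvol : ENNReal.ofReal v ≤ volume {y : V | ‖y‖ ∈ Icc (5 / 4) (3 / 2)})
    (s : Finset ℕ) (a : ℕ → ℂ) :
    ENNReal.ofReal ((v / 2) ^ (1 / p')) ^ p * ∑ k ∈ s, ‖a k‖ₑ ^ p
      ≤ 2 * lorentzENorm volume p' p (𝓕 (∑ k ∈ s, a k • lpDilate p (2 ^ k ^ 2) f)) ^ p := by
  let w (k : ℕ) : ℝ := (2 ^ k ^ 2) ^ finrank ℝ V
  have hw (k : ℕ) : 0 < w k := by positivity
  have hdisj := pairwise_disjoint_Ico_half_div hw (two_mul_two_pow_sq_pow_le finrank_pos) hv.le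
  have hlower := tsum_le_lorentzENorm_rpow (ι := s) (t := fun k => v / w k)
    (b := fun k => ‖a k‖ₑ * ENNReal.ofReal (w k ^ (1 / p'))) hpp'.symm.pos hpp'.pos
    (fun k => div_pos hv (hw k)) (hdisj.comp_of_injective Subtype.val_injective)
    (fun k => ofReal_div_le_volume_norm_smul_mem (by positivity) hvol) fun k y hy =>
      (enorm_fourier_sum_smul_lpDilate hpp' hf hf1 hf0 a k.2 hy).ge
  have hterm (k : ℕ) : ENNReal.ofReal ((v / w k / 2) ^ (1 / p')) *
      (‖a k‖ₑ * ENNReal.ofReal (w k ^ (1 / p'))) =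
        ENNReal.ofReal ((v / 2) ^ (1 / p')) * ‖a k‖ₑ := by
    have := hw k
    rw [mul_left_comm, mul_comm, ← ENNReal.ofReal_mul (by positivity),
      ← Real.mul_rpow (by positivity) (by positivity), div_right_comm,
      div_mul_cancel₀ _ this.ne']
  simp only [hterm] at hlower
  rw [Finset.tsum_subtype s fun k => (ENNReal.ofReal ((v / 2) ^ (1 / p')) * ‖a k‖ₑ) ^ p] at hlower
  simpa only [ENNReal.mul_rpow_of_nonneg _ _ hpp'.nonneg, Finset.mul_sum] using hlower

lemma exists_sum_rpow_le_lorentzENorm_fourier [Nontrivial V] (hpp' : p.HolderConjugate p')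
    {f : V → ℂ} (hf : Integrable f) (hf1 : ∀ y, ‖y‖ ∈ Icc (5 / 4) (3 / 2) → 𝓕 f y = 1)
    (hf0 : ∀ y, ‖y‖ ∉ Ioo 1 2 → 𝓕 f y = 0) :
    ∃ M : ℝ≥0, ∀ (s : Finset ℕ) (a : ℕ → ℂ), (∑ k ∈ s, ‖a k‖ₑ ^ p) ^ (1 / p)
      ≤ M * lorentzENorm volume p' p (𝓕 (∑ k ∈ s, a k • lpDilate p (2 ^ k ^ 2) f)) := by
  have hp := hpp'.pos
  obtain ⟨v, hv, hvol⟩ := ENNReal.lt_iff_exists_nnreal_btwn.mp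
    (volume_norm_mem_Icc_pos (V := V) (a := 5 / 4) (b := 3 / 2) (by norm_num) (by norm_num))
  have hv : (0 : ℝ) < v := by simpa using hv
  set c := ENNReal.ofReal ((v / 2 : ℝ) ^ (1 / p'))
  have hc0 : c ≠ 0 := (ENNReal.ofReal_pos.mpr (by positivity)).ne'
  have hc_top : c ≠ ∞ := ENNReal.ofReal_ne_top
  refine ⟨(c⁻¹ * 2 ^ (1 / p)).toNNReal, fun s a => ?_⟩
  set L := lorentzENorm volume p' p (𝓕 (∑ k ∈ s, a k • lpDilate p (2 ^ k ^ 2) f))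
  have hlower : c ^ p * ∑ k ∈ s, ‖a k‖ₑ ^ p ≤ 2 * L ^ p :=
    mul_sum_rpow_le_lorentzENorm_fourier_rpow hpp' hf hf1 hf0 hv (by simpa using hvol.le) s a
  calc (∑ k ∈ s, ‖a k‖ₑ ^ p) ^ (1 / p) = c⁻¹ * (c ^ p * ∑ k ∈ s, ‖a k‖ₑ ^ p) ^ (1 / p) := by
        rw [ENNReal.mul_rpow_of_nonneg _ _ (by positivity), one_div, ENNReal.rpow_rpow_inv hp.ne',
          ENNReal.inv_mul_cancel_left hc0 hc_top]
    _ ≤ c⁻¹ * (2 * L ^ p) ^ (1 / p) := by gcongr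
    _ = (c⁻¹ * 2 ^ (1 / p)).toNNReal * L := by
        rw [ENNReal.coe_toNNReal (by finiteness), ENNReal.mul_rpow_of_nonneg _ _ (by positivity),
          one_div, ENNReal.rpow_rpow_inv hp.ne', mul_assoc]

end LowerEstimate

section DilateFamily

variable {V : Type*} [NormedAddCommGroup V] [InnerProductSpace ℝ V] [FiniteDimensional ℝ V]
  [MeasurableSpace V] [BorelSpace V] {p p' : ℝ}

lemma exists_eLpNorm_sum_equiv_lorentzENorm_fourier_sum [Nontrivial V]
    (hpp' : p.HolderConjugate p') :
    ∃ f : ℕ → V → ℝ, (∀ k, Integrable (f k)) ∧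
      (∀ k, MemLp (f k) (ENNReal.ofReal p)) ∧
      ∃ M₁ M₂ : ℝ≥0, ∀ (s : Finset ℕ) (a : ℕ → ℂ),
        eLpNorm (∑ k ∈ s, a k • fun x => (f k x : ℂ)) (ENNReal.ofReal p) volume
          ≤ M₁ * (∑ k ∈ s, ‖a k‖ₑ ^ p) ^ (1 / p) ∧
        (∑ k ∈ s, ‖a k‖ₑ ^ p) ^ (1 / p)
          ≤ M₂ * lorentzENorm volume p' p (𝓕 (∑ k ∈ s, a k • fun x => (f k x : ℂ))) := by
  obtain ⟨ρ, hρ1, hρ0⟩ := exists_schwartzMap_fourier_annulus (V := V)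
  set φ : 𝓢(V, ℂ) := SchwartzMap.postcompCLM Complex.ofRealCLM ρ
  have hφ (k : ℕ) : (fun x => ((lpDilate p (2 ^ k ^ 2) ρ x : ℝ) : ℂ))
      = lpDilate p (2 ^ k ^ 2) φ := by
    funext x
    simp [lpDilate, φ]
  obtain ⟨M₁, hupper⟩ := exists_eLpNorm_sum_smul_lpDilate_le (𝕜 := ℂ) hpp'.lt.le φ
  obtain ⟨M₂, hlower⟩ := exists_sum_rpow_le_lorentzENorm_fourier hpp'
    (φ.integrable (μ := volume)) hρ1 hρ0
  refine ⟨fun k => lpDilate p (2 ^ k ^ 2) ρ, fun k => ?_, fun k => ?_, M₁, M₂, fun s a => ?_⟩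
  · exact integrable_lpDilate (by positivity) (ρ.integrable (μ := volume))
  · exact memLp_lpDilate hpp'.pos (by positivity) (ρ.memLp _)
  · simp only [hφ]
    exact ⟨hupper s a, hlower s a⟩

end DilateFamily

section RealToComplex

variable {d : ℕ} {q : ℝ≥0∞} [Fact (1 ≤ q)]
  (u : Lp ℝ q (volume : Measure (EuclideanSpace ℝ (Fin d))))

lemma coeFn_realToComplexLp : realToComplexLp d q u =ᵐ[volume] fun x => (u x : ℂ) :=
  Complex.ofRealCLM.coeFn_compLpL u

lemma norm_realToComplexLp : ‖realToComplexLp d q u‖ = ‖u‖ := by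
  rw [Lp.norm_def, Lp.norm_def, eLpNorm_congr_ae (coeFn_realToComplexLp u)]
  exact congrArg _ (eLpNorm_congr_norm_ae (ae_of_all _ fun x => Complex.norm_real _))

end RealToComplex

section LowerBound

variable {d : ℕ} {p r s : ℝ}

lemma linearCombination_coeFn_ae_eq {α ι : Type*} [MeasurableSpace α] {μ : Measure α} {q : ℝ≥0∞}
    {v : ι → Lp ℂ q μ} {f : ι → α → ℂ} (hv : ∀ k, v k =ᵐ[μ] f k) (a : ι →₀ ℂ) :
    Finsupp.linearCombination ℂ v a =ᵐ[μ] ∑ k ∈ a.support, a k • f k := by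
  rw [Finsupp.linearCombination_apply, Finsupp.sum]
  refine (Lp.coeFn_finsetSum _ _).trans (eventuallyEq_sum fun k _ => ?_)
  exact (Lp.coeFn_smul _ _).trans ((hv k).const_smul (a k))

variable [Fact (1 ≤ ENNReal.ofReal p)] {hr : 0 < r} {hs : 0 < s}
  {T : Lp ℂ (ENNReal.ofReal p) (volume : Measure (EuclideanSpace ℝ (Fin d))) →ₗ[ℂ]
    lorentzSpace (volume : Measure (EuclideanSpace ℝ (Fin d))) hr hs}

lemma IsFourierTransform.lorentzENorm_fourier_eq (hT : IsFourierTransform T)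
    {x : Lp ℂ (ENNReal.ofReal p) (volume : Measure (EuclideanSpace ℝ (Fin d)))}
    {f : EuclideanSpace ℝ (Fin d) → ℂ} (hf : Integrable f) (hxf : x =ᵐ[volume] f) :
    lorentzENorm volume r s (𝓕 f)
      = ENNReal.ofReal (((2 * Real.pi) ^ finrank ℝ (EuclideanSpace ℝ (Fin d))) ^ (-(1 / r)))
        * ENNReal.ofReal ‖T x‖ := by
  have hTx : (T x : EuclideanSpace ℝ (Fin d) →ₘ[volume] ℂ) =ᵐ[volume] fourierIntegralFun f := by
    refine (hT.eq_integral x (hf.congr hxf.symm)).trans (ae_of_all _ fun y => ?_)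
    exact integral_congr_ae (hxf.mono fun t ht => by simp only [ht])
  have hnorm : ENNReal.ofReal ‖T x‖ = lorentzENorm volume r s (fourierIntegralFun f) :=
    (ENNReal.ofReal_toReal (T x).2.ne).trans (lorentzENorm_congr _ _ hTx)
  rw [hnorm, ← lorentzENorm_comp_smul _ hs _ Real.two_pi_pos, fourierIntegralFun_eq_fourier]
  simp only [inv_smul_smul₀ Real.two_pi_pos.ne']

end LowerBound

section Span

variable {d : ℕ} {p p' : ℝ} [Fact (1 ≤ ENNReal.ofReal p)] (hpp' : p.HolderConjugate p')
  {T : Lp ℂ (ENNReal.ofReal p) (volume : Measure (EuclideanSpace ℝ (Fin d))) →ₗ[ℂ]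
    lorentzSpace (volume : Measure (EuclideanSpace ℝ (Fin d))) hpp'.symm.pos hpp'.pos}

lemma exists_enorm_linearCombination_equiv (hd : 1 ≤ d) (hT : IsFourierTransform T) :
    ∃ (u : ℕ → Lp ℝ (ENNReal.ofReal p) (volume : Measure (EuclideanSpace ℝ (Fin d))))
      (M₁ M₂ : ℝ≥0), ∀ a : ℕ →₀ ℂ,
        ‖Finsupp.linearCombination ℂ (realToComplexLp d (ENNReal.ofReal p) ∘ u) a‖ₑ
          ≤ M₁ * (∑ k ∈ a.support, ‖a k‖ₑ ^ p) ^ (1 / p) ∧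
        (∑ k ∈ a.support, ‖a k‖ₑ ^ p) ^ (1 / p) ≤ M₂ * ENNReal.ofReal
          ‖T (Finsupp.linearCombination ℂ (realToComplexLp d (ENNReal.ofReal p) ∘ u) a)‖ := by
  have : Nonempty (Fin d) := ⟨⟨0, hd⟩⟩
  obtain ⟨f, hf, hfp, M₁, M₂, hM⟩ := exists_eLpNorm_sum_equiv_lorentzENorm_fourier_sum
    (V := EuclideanSpace ℝ (Fin d)) hpp'
  set u := fun k => (hfp k).toLp (f k)
  have hu (k : ℕ) : (realToComplexLp d (ENNReal.ofReal p) ∘ u) k =ᵐ[volume] fun x => (f k x : ℂ) :=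
    (coeFn_realToComplexLp _).trans ((hfp k).coeFn_toLp.mono fun _ hx => congrArg _ hx)
  refine ⟨u, M₁, M₂ * Real.toNNReal
    (((2 * Real.pi) ^ finrank ℝ (EuclideanSpace ℝ (Fin d))) ^ (-(1 / p'))), fun a => ?_⟩
  have hx := linearCombination_coeFn_ae_eq hu a
  have hint : Integrable (∑ k ∈ a.support, a k • fun x => (f k x : ℂ)) :=
    integrable_finsetSum' _ fun k _ => (hf k).ofReal.smul (a k)
  obtain ⟨hupper, hlower⟩ := hM a.support a
  rw [← eLpNorm_congr_ae hx, ← Lp.enorm_def] at hupper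
  rw [hT.lorentzENorm_fourier_eq hint hx, ← mul_assoc] at hlower
  rw [ENNReal.coe_mul]
  exact ⟨hupper, hlower⟩

lemma exists_linearIndependent_norm_le (hd : 1 ≤ d) (hT : IsFourierTransform T) :
    ∃ u : ℕ → Lp ℝ (ENNReal.ofReal p) (volume : Measure (EuclideanSpace ℝ (Fin d))),
      LinearIndependent ℂ (realToComplexLp d (ENNReal.ofReal p) ∘ u) ∧
      ∃ M : ℝ≥0, ∀ x ∈ Submodule.span ℂ
        (range (realToComplexLp d (ENNReal.ofReal p) ∘ u)), ‖x‖ ≤ M * ‖T x‖ := by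
  obtain ⟨u, M₁, M₂, hu⟩ := exists_enorm_linearCombination_equiv hpp' hd hT
  refine ⟨u, linearIndependent_iff.mpr fun a ha => ?_, M₁ * M₂, fun x hx => ?_⟩
  · have hT0 : ‖T 0‖ = 0 := by
      obtain ⟨C, hC⟩ := hT.bounded
      exact le_antisymm (by simpa using hC 0) ENNReal.toReal_nonneg
    have hsum := (hu a).2
    rw [ha, hT0, ENNReal.ofReal_zero, mul_zero, nonpos_iff_eq_zero,
      ENNReal.rpow_eq_zero_iff_of_pos (one_div_pos.mpr hpp'.pos), Finset.sum_eq_zero_iff] at hsum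
    ext k
    by_contra hk
    exact hk (enorm_eq_zero.mp ((ENNReal.rpow_eq_zero_iff_of_pos hpp'.pos).mp
      (hsum k (Finsupp.mem_support_iff.mpr hk))))
  · rw [← Finsupp.range_linearCombination] at hx
    obtain ⟨a, rfl⟩ := hx
    obtain ⟨hupper, hlower⟩ := hu a
    refine (ENNReal.ofReal_le_ofReal_iff (mul_nonneg (by positivity) ENNReal.toReal_nonneg)).mp ?_
    rw [ENNReal.ofReal_mul (by positivity), ofReal_norm, ENNReal.ofReal_coe_nnreal, ENNReal.coe_mul,
      mul_assoc]
    exact hupper.trans (mul_le_mul_right hlower _)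

end Span

end

theorem theorem3p2 (d : ℕ) (hd : 1 ≤ d) (p p' : ℝ) (hp1 : 1 < p) (hp2 : p < 2)
    (hpp' : p.HolderConjugate p') [Fact (1 ≤ ENNReal.ofReal p)] :
    ∃ T : Lp ℂ (ENNReal.ofReal p) (volume : Measure (EuclideanSpace ℝ (Fin d))) →ₗ[ℂ]
        lorentzSpace (volume : Measure (EuclideanSpace ℝ (Fin d))) hpp'.symm.pos hpp'.pos,
      IsFourierTransform T ∧
      -- complex scalars
      ¬ IsStrictlySingular T ∧
      -- real scalars, on the space of real-valued functions
      ¬ IsStrictlySingular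
        ((T.restrictScalars ℝ) ∘ₗ realToComplexLp d (ENNReal.ofReal p)) := by
  obtain ⟨T, hT⟩ := exists_isFourierTransform hpp' hp2
  obtain ⟨u, hu, M, hM⟩ := exists_linearIndependent_norm_le hpp' hd hT
  have hadd := lorentzSpace_norm_add_le (μ := (volume : Measure (EuclideanSpace ℝ (Fin d))))
    hpp'.symm.pos hpp'.pos
  refine ⟨T, hT, not_isStrictlySingular_of_norm_le hT.bounded hadd hu hM, ?_⟩
  have hbounded : IsBoundedOperator
      ((T.restrictScalars ℝ) ∘ₗ realToComplexLp d (ENNReal.ofReal p)) := by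
    obtain ⟨C, hC⟩ := hT.bounded
    exact ⟨C, fun x => norm_realToComplexLp x ▸ hC _⟩
  have hu_real : LinearIndependent ℝ u :=
    LinearIndependent.of_comp (realToComplexLp d (ENNReal.ofReal p)) (hu.restrict_scalars' ℝ)
  refine not_isStrictlySingular_of_norm_le (M := M) hbounded hadd hu_real fun x hx => ?_
  rw [← norm_realToComplexLp x]
  refine hM _ (Submodule.span_le_restrictScalars ℝ ℂ _ ?_)
  rw [range_comp, ← Submodule.map_span]
  exact Submodule.mem_map_of_mem hx
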